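/- Let $\Omega\subset\mathbb C$ be a bounded simply connected domain, let $\delta_\Omega(z)=\operatorname{dist}(z,\partial\Omega)$, let $m$ be Lebesgue measure on $\mathbb C$, and let $\mu$ be a positive Borel measure on $\Omega$. Let $0<p\le q<\infty$ and $\alpha>-1$. Fix a constant $0<\kappa\le\frac12$ and call $B(z,r)\subset\Omega$ (with $z\in\Omega$) a Whitney ball if $\kappa\,\delta_\Omega(z)\le r\le\frac12\delta_\Omega(z)$. Fix a constant $C\ge\frac1\pi$ and call a nonnegative, measurable, locally bounded function $u$ on $\Omega$ $C$-quasi-nearly subharmonic if $$u(a)\le \frac{C}{r^2}\int_{B(a,r)}u\,dm\qquad\text{whenever } B(a,r)\subset\Omega .$$ Let $\mathcal A^p_\alpha(\Omega)$ be the space of all analytic functions $f$ in $\Omega$ with $\|f\|_{\mathcal A^p_\alpha(\Omega)}=\left(\int_\Omega|f|^p\delta_\Omega^\alpha\,dm\right)^{1/p}<\infty$. Then the following three conditions are equivalent. (i) There is $c>0$ such that $\mu(B(z,r))\le c\,r^{(2+\alpha)q/p}$ for all Whitney balls $B(z,r)\subset\Omega$. (ii) There is $C'>0$ such that for every $C$-quasi-nearly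 subharmonic function $g\ge0$ in $\Omega$ $$\left(\int_\Omega g^q\,d\mu\right)^{1/q}\le C'\left(\int_\Omega g^p\,\delta_\Omega^\alpha\,dm\right)^{1/p}.$$ (iii) $\mu$ is a $q$-Carleson measure for $\mathcal A^p_\alpha(\Omega)$, i.e. there is $K>0$ such that $$\left(\int_\Omega|f|^q\,d\mu\right)^{1/q}\le K\,\|f\|_{\mathcal A^p_\alpha(\Omega)}\qquad\text{for all } f\in\mathcal A^p_\alpha(\Omega).$$ -/

import Mathlib

open MeasureTheory Metric
open scoped ENNReal Topology

/-- Distance `δ_Ω(z)` from `z` to the boundary of `Ω`. -/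
noncomputable def bdryDist (Ω : Set ℂ) (z : ℂ) : ℝ :=
  infDist z (frontier Ω)

/-- `B(z, r)` is a Whitney ball of `Ω`, with fixed lower constant `κ`:
`B(z, r) ⊆ Ω` and `κ * δ_Ω(z) ≤ r ≤ δ_Ω(z) / 2`. -/
structure IsWhitneyBall (κ : ℝ) (Ω : Set ℂ) (z : ℂ) (r : ℝ) : Prop where
  mem : z ∈ Ω
  subset : ball z r ⊆ Ω
  lower : κ * bdryDist Ω z ≤ r
  upper : r ≤ bdryDist Ω z / 2

/-- `u` is `C`-quasi-nearly subharmonic on the open set `Ω`: it is nonnegative, measurable and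
locally bounded on `Ω`, and `u(a) ≤ (C / r²) ∫_{B(a,r)} u dm` whenever `B(a, r) ⊆ Ω`.
The area integral of a nonnegative function is taken in `[0, ∞]`, since `u` need not be
integrable on a ball that reaches the boundary. Only the values of `u` on `Ω` matter. -/
structure IsQuasiNearlySubharmonic (C : ℝ) (Ω : Set ℂ) (u : ℂ → ℝ) : Prop where
  nonneg : ∀ z ∈ Ω, 0 ≤ u z
  measurable : Measurable (Ω.domRestrict u)
  locallyBounded : ∀ z ∈ Ω, ∃ M : ℝ, ∀ᶠ w in 𝓝[Ω] z, u w ≤ M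
  le_mean : ∀ (a : ℂ) (r : ℝ), 0 < r → ball a r ⊆ Ω →
    ENNReal.ofReal (u a) ≤
      ENNReal.ofReal (C / r ^ 2) * ∫⁻ w in ball a r, ENNReal.ofReal (u w)

/-- The (quasi-)norm `(∫_Ω |f|^p δ_Ω^α dm)^{1/p}`, with values in `[0, ∞]`. -/
noncomputable def bergmanNorm (Ω : Set ℂ) (p α : ℝ) (f : ℂ → ℂ) : ℝ≥0∞ :=
  (∫⁻ z in Ω, ENNReal.ofReal (‖f z‖ ^ p * bdryDist Ω z ^ α)) ^ (1 / p)

/-- The weighted Bergman space `A^p_α(Ω)`: functions analytic in the open set `Ω` with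
`∫_Ω |f|^p δ_Ω^α dm < ∞`. Only the values of `f` on `Ω` matter. -/
def bergmanSpace (Ω : Set ℂ) (p α : ℝ) : Set (ℂ → ℂ) :=
  {f | DifferentiableOn ℂ f Ω ∧
    ∫⁻ z in Ω, ENNReal.ofReal (‖f z‖ ^ p * bdryDist Ω z ^ α) < ∞}

/-- `μ` is a `q`-Carleson measure on `Ω` for the space `X` of functions with norm `N`:
`(∫_Ω |f|^q dμ)^{1/q} ≤ K * N f` for all `f ∈ X`, with one finite constant `K > 0`. -/
def IsCarlesonMeasure (Ω : Set ℂ) (q : ℝ) (X : Set (ℂ → ℂ)) (N : (ℂ → ℂ) → ℝ≥0∞)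
    (μ : Measure ℂ) : Prop :=
  ∃ K : ℝ, 0 < K ∧ ∀ f ∈ X,
    (∫⁻ z in Ω, ENNReal.ofReal (‖f z‖ ^ q) ∂μ) ^ (1 / q) ≤ ENNReal.ofReal K * N f

open Set Filter ComplexConjugate

/-! ### Injective holomorphic functions and holomorphic logarithms -/

/-! The ball condition gives the inequality for quasi-nearly subharmonic `g` by averaging. A power
`g ^ p` still satisfies a mean value inequality (`exists_rpow_le_mean`), so `g z ^ p` is at most a
constant times `δ(z)^(-(2+α)) J(z)`, where `J(z)` is the integral of `g ^ p δ^α` over `B(z,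
δ(z)/4)`. Raise this to the power `q / p ≥ 1` and use `J^(q/p) ≤ I^(q/p-1) J`, with `I` the integral
over all of `Ω`. Integrating in `μ` and applying Tonelli, the points `z` whose ball contains `w` lie
in the Whitney ball `B(w, δ(w)/2)`, whose `μ`-measure cancels the weight
(`lintegral_weighted_average_le`).

The Carleson property follows because `‖f‖` is quasi-nearly subharmonic with constant `1 / π`.

The return to the ball condition uses simple connectedness. For a Whitney ball centred at `z`, let
`ψ` be a Riemann map of `Ω` with `ψ z = 0`, and test with `f = (ψ')^((2+α)/p)`. Schwarz–Pick and a
weak Koebe theorem (`one_sub_norm_le_mul_bdryDist`) make `|ψ'| δ` comparable to `1 - |ψ|`. The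
change of variables `w = ψ(ζ)` then bounds the norm of `f` by the integral of `(1 - |w|)^α` over the
disc, uniformly in `z`. On the Whitney ball `|ψ'|` is at least a constant over the radius, so the
Carleson inequality bounds the measure of the ball.

The Riemann map itself is obtained from Koebe's extremal problem: maximise `|f'(z₀)|` among
injective maps into the disc, and improve any non-surjective candidate by a square root. -/

theorem Set.InjOn.nhds_le_map_of_differentiableOn {U : Set ℂ} (hU : IsOpen U) {f : ℂ → ℂ}
    (hf : DifferentiableOn ℂ f U) (hi : InjOn f U) {a : ℂ} (ha : a ∈ U) :
    𝓝 (f a) ≤ map f (𝓝 a) := by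
  have hUa := hU.mem_nhds ha
  refine (hf.analyticAt hUa).eventually_constant_or_nhds_le_map_nhds.resolve_left fun h ↦ ?_
  have h' : ∀ᶠ z in 𝓝 a, z = a := by
    filter_upwards [h, hUa] with z hz hzU using hi hzU ha hz
  have : ∀ᶠ z in 𝓝[≠] a, False := by
    filter_upwards [h'.filter_mono nhdsWithin_le_nhds, self_mem_nhdsWithin] with z hz hz'
      using hz' hz
  exact this.exists.elim fun _ h ↦ h

theorem Set.InjOn.continuousAt_invFunOn {U : Set ℂ} (hU : IsOpen U) {f : ℂ → ℂ}
    (hf : DifferentiableOn ℂ f U) (hi : InjOn f U) {a : ℂ} (ha : a ∈ U) :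
    ContinuousAt (Function.invFunOn f U) (f a) := by
  rw [ContinuousAt, hi.leftInvOn_invFunOn ha]
  refine (map_mono (hi.nhds_le_map_of_differentiableOn hU hf ha)).trans ?_
  rw [map_map]
  refine Tendsto.congr' ?_ tendsto_id
  filter_upwards [hU.mem_nhds ha] with z hz using (hi.leftInvOn_invFunOn hz).symm

theorem Set.InjOn.eventually_apply_invFunOn {U : Set ℂ} (hU : IsOpen U) {f : ℂ → ℂ}
    (hf : DifferentiableOn ℂ f U) (hi : InjOn f U) {a : ℂ} (ha : a ∈ U) :
    ∀ᶠ y in 𝓝 (f a), f (Function.invFunOn f U y) = y := by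
  refine Eventually.filter_mono (hi.nhds_le_map_of_differentiableOn hU hf ha) ?_
  rw [eventually_map]
  filter_upwards [hU.mem_nhds ha] with z hz using by rw [hi.leftInvOn_invFunOn hz]

/-- An injective holomorphic function on an open set has a nonvanishing derivative. -/
theorem Set.InjOn.deriv_ne_zero_of_differentiableOn {U : Set ℂ} (hU : IsOpen U) {f : ℂ → ℂ}
    (hf : DifferentiableOn ℂ f U) (hi : InjOn f U) {a : ℂ} (ha : a ∈ U) : deriv f a ≠ 0 := by
  intro h0
  have hUa := hU.mem_nhds ha
  have hda : AnalyticAt ℂ (deriv f) a := (hf.analyticAt hUa).deriv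
  set g := Function.invFunOn f U
  -- Zeros of `f'` are isolated, as otherwise `f` would be locally constant. The continuous inverse
  -- is therefore holomorphic off `f a`, the singularity there is removable, and the chain rule for
  -- `g ∘ f = id` rules out `f' a = 0`.
  have hne : ∀ᶠ z in 𝓝[≠] a, deriv f z ≠ 0 := by
    refine hda.eventually_eq_zero_or_eventually_ne_zero.resolve_left fun h ↦ ?_
    obtain ⟨r, hr, hrs⟩ := Metric.eventually_nhds_iff_ball.1 (h.and hUa)
    have hconst : ∀ z ∈ ball a r, f z = f a := fun z hz ↦
      (isOpen_ball.is_const_of_deriv_eq_zero (convex_ball a r).isPreconnected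
        (hf.mono fun z hz ↦ (hrs z hz).2) (fun z hz ↦ (hrs z hz).1) hz (mem_ball_self hr))
    have hz : a + (r / 2 : ℝ) ∈ ball a r := by
      rw [mem_ball, dist_eq_norm, add_sub_cancel_left, Complex.norm_real, Real.norm_eq_abs,
        abs_of_pos (half_pos hr)]
      linarith
    have := hi (hrs _ hz).2 ha (hconst _ hz)
    simp [hr.ne'] at this
  have hg : AnalyticAt ℂ g (f a) := by
    refine Complex.analyticAt_of_differentiable_on_punctured_nhds_of_continuousAt ?_
      (hi.continuousAt_invFunOn hU hf ha)
    rw [eventually_nhdsWithin_iff] at hne ⊢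
    refine Eventually.filter_mono (hi.nhds_le_map_of_differentiableOn hU hf ha) ?_
    rw [eventually_map]
    filter_upwards [hne, hUa] with z hz hzU hza
    have hd := hz (fun h : z = a ↦ hza (by rw [h]; rfl))
    refine (HasDerivAt.of_local_left_inverse (hi.continuousAt_invFunOn hU hf hzU) ?_ hd
      (hi.eventually_apply_invFunOn hU hf hzU)).differentiableAt
    rw [hi.leftInvOn_invFunOn hzU]
    exact (hf.differentiableAt (hU.mem_nhds hzU)).hasDerivAt
  have hcomp : HasDerivAt (g ∘ f) (deriv g (f a) * deriv f a) a :=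
    hg.differentiableAt.hasDerivAt.comp a (hf.differentiableAt hUa).hasDerivAt
  have hid : HasDerivAt (g ∘ f) 1 a := by
    refine (hasDerivAt_id a).congr_of_eventuallyEq ?_
    filter_upwards [hUa] with z hz using hi.leftInvOn_invFunOn hz
  have := hcomp.unique hid
  simp [h0] at this

theorem Set.InjOn.hasDerivAt_invFunOn {U : Set ℂ} (hU : IsOpen U) {f : ℂ → ℂ}
    (hf : DifferentiableOn ℂ f U) (hi : InjOn f U) {a : ℂ} (ha : a ∈ U) :
    HasDerivAt (Function.invFunOn f U) (deriv f a)⁻¹ (f a) := by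
  refine HasDerivAt.of_local_left_inverse (hi.continuousAt_invFunOn hU hf ha) ?_
    (hi.deriv_ne_zero_of_differentiableOn hU hf ha) (hi.eventually_apply_invFunOn hU hf ha)
  rw [hi.leftInvOn_invFunOn ha]
  exact (hf.differentiableAt (hU.mem_nhds ha)).hasDerivAt

/-- A nonvanishing holomorphic function on a simply connected open set has a holomorphic
logarithm. -/
theorem IsSimplyConnected.exists_differentiableOn_exp_eq {U : Set ℂ} (hU : IsOpen U)
    (hsc : IsSimplyConnected U) {F : ℂ → ℂ} (hF : DifferentiableOn ℂ F U)
    (h0 : ∀ z ∈ U, F z ≠ 0) :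
    ∃ l : ℂ → ℂ, DifferentiableOn ℂ l U ∧ ∀ z ∈ U, Complex.exp (l z) = F z := by
  obtain ⟨l, hlc, hl⟩ := Complex.exists_continuousOn_eqOn_exp_comp hsc hU hF.continuousOn
    (by rintro ⟨z, hz, h⟩; exact h0 z hz h)
  refine ⟨l, fun a ha ↦ ?_, fun z hz ↦ hl hz⟩
  have hUa := hU.mem_nhds ha
  have hla : ContinuousAt l a := hlc.continuousAt hUa
  have hFa := hF.differentiableAt hUa
  -- Near `a` the increment of `l` has imaginary part in `(-π, π)`, so the continuous branch is a
  -- translate of the principal logarithm.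
  have hlog : ∀ᶠ z in 𝓝 a, l z = Complex.log (F z / F a) + l a := by
    have him : ContinuousAt (fun z ↦ (l z - l a).im) a :=
      Complex.continuous_im.continuousAt.comp (hla.sub continuousAt_const)
    have hmem : ∀ᶠ z in 𝓝 a, (l z - l a).im ∈ Ioo (-Real.pi) Real.pi :=
      him.eventually_mem (Ioo_mem_nhds (by simp [Real.pi_pos]) (by simp [Real.pi_pos]))
    filter_upwards [hmem, hUa] with z hz hzU
    have h1 : Complex.exp (l z) = F z := hl hzU
    have h2 : Complex.exp (l a) = F a := hl ha
    rw [← h1, ← h2, ← Complex.exp_sub, Complex.log_exp hz.1 hz.2.le, sub_add_cancel]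
  refine DifferentiableAt.differentiableWithinAt ?_
  refine DifferentiableAt.congr_of_eventuallyEq ?_ hlog
  refine (DifferentiableAt.clog (hFa.div_const _) ?_).add_const _
  rw [div_self (h0 a ha)]
  simp

/-! ### Möbius transformations of the unit disc -/

/-- The automorphism `z ↦ (z - a) / (1 - conj a * z)` of the unit disc. -/
noncomputable def discMobius (a z : ℂ) : ℂ := (z - a) / (1 - conj a * z)

theorem one_sub_conj_mul_ne_zero {a z : ℂ} (ha : ‖a‖ < 1) (hz : ‖z‖ < 1) :
    1 - conj a * z ≠ 0 := by
  intro h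
  have h1 : ‖conj a * z‖ = 1 := by rw [← sub_eq_zero.1 h]; simp
  rw [norm_mul, RCLike.norm_conj] at h1
  nlinarith [norm_nonneg a, norm_nonneg z]

theorem norm_discMobius_lt_one {a z : ℂ} (ha : ‖a‖ < 1) (hz : ‖z‖ < 1) :
    ‖discMobius a z‖ < 1 := by
  have hne := one_sub_conj_mul_ne_zero ha hz
  rw [discMobius, norm_div, div_lt_one (norm_pos_iff.2 hne)]
  refine lt_of_pow_lt_pow_left₀ 2 (norm_nonneg _) ?_
  have key : ‖1 - conj a * z‖ ^ 2 - ‖z - a‖ ^ 2 = (1 - ‖a‖ ^ 2) * (1 - ‖z‖ ^ 2) := by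
    simp only [← Complex.normSq_eq_norm_sq, Complex.normSq_apply, Complex.sub_re, Complex.sub_im,
      Complex.one_re, Complex.one_im, Complex.mul_re, Complex.mul_im, Complex.conj_re,
      Complex.conj_im]
    ring
  have h1 : 0 < 1 - ‖a‖ ^ 2 := by nlinarith [norm_nonneg a]
  have h2 : 0 < 1 - ‖z‖ ^ 2 := by nlinarith [norm_nonneg z]
  nlinarith [mul_pos h1 h2]

@[simp] theorem discMobius_self (a : ℂ) : discMobius a a = 0 := by simp [discMobius]

theorem discMobius_eq_zero {a z : ℂ} (ha : ‖a‖ < 1) (hz : ‖z‖ < 1) :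
    discMobius a z = 0 ↔ z = a := by
  rw [discMobius, div_eq_zero_iff, sub_eq_zero]
  simp [one_sub_conj_mul_ne_zero ha hz]

theorem one_sub_conj_mul_self (a : ℂ) : 1 - conj a * a = ((1 - ‖a‖ ^ 2 : ℝ) : ℂ) := by
  rw [← Complex.normSq_eq_conj_mul_self, Complex.normSq_eq_norm_sq]; push_cast; ring

theorem injOn_discMobius {a : ℂ} (ha : ‖a‖ < 1) : InjOn (discMobius a) (ball 0 1) := by
  intro z hz w hw h
  rw [mem_ball_zero_iff] at hz hw
  rw [discMobius, discMobius, div_eq_div_iff (one_sub_conj_mul_ne_zero ha hz)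
    (one_sub_conj_mul_ne_zero ha hw)] at h
  have h2 : (z - w) * (1 - conj a * a) = 0 := by linear_combination h
  exact sub_eq_zero.1 ((mul_eq_zero.1 h2).resolve_right (one_sub_conj_mul_ne_zero ha ha))

theorem hasDerivAt_discMobius {a z : ℂ} (ha : ‖a‖ < 1) (hz : ‖z‖ < 1) :
    HasDerivAt (discMobius a) ((1 - conj a * a) / (1 - conj a * z) ^ 2) z := by
  have h := ((hasDerivAt_id z).sub_const a).div
    (((hasDerivAt_id z).const_mul (conj a)).const_sub 1) (one_sub_conj_mul_ne_zero ha hz)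
  refine h.congr_deriv ?_
  simp only [id]
  ring

/-- The **Schwarz–Pick lemma** at the centre of a disc. -/
theorem norm_deriv_mul_le_one_sub_sq {f : ℂ → ℂ} {c : ℂ} {R : ℝ} (hR : 0 < R)
    (hf : DifferentiableOn ℂ f (ball c R)) (hm : MapsTo f (ball c R) (ball 0 1)) :
    ‖deriv f c‖ * R ≤ 1 - ‖f c‖ ^ 2 := by
  have hc : ‖f c‖ < 1 := by simpa using hm (mem_ball_self hR)
  have hpos : 0 < 1 - ‖f c‖ ^ 2 := by nlinarith [norm_nonneg (f c)]
  have hfc := (hf.differentiableAt (isOpen_ball.mem_nhds (mem_ball_self hR))).hasDerivAt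
  have hd := (hasDerivAt_discMobius hc hc).comp c hfc
  have hle := Complex.norm_deriv_le_div_of_mapsTo_ball (f := discMobius (f c) ∘ f) (c := c)
    (R₁ := R) (R₂ := 1) (fun z hz ↦ ?_) (fun z hz ↦ ?_) hR
  · rw [hd.deriv, one_sub_conj_mul_self, norm_mul, norm_div, norm_pow, Complex.norm_real,
      Real.norm_of_nonneg hpos.le, le_div_iff₀ hR] at hle
    have h2 : (1 - ‖f c‖ ^ 2) / (1 - ‖f c‖ ^ 2) ^ 2 * ‖deriv f c‖ * R
        = ‖deriv f c‖ * R / (1 - ‖f c‖ ^ 2) := by field_simp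
    rwa [h2, div_le_one hpos] at hle
  · have hz1 : ‖f z‖ < 1 := by simpa using hm hz
    exact (hasDerivAt_discMobius hc hz1).differentiableAt.comp_differentiableWithinAt z (hf z hz)
  · have hz1 : ‖f z‖ < 1 := by simpa using hm hz
    simpa using (norm_discMobius_lt_one hc hz1).le

/-! ### The Riemann mapping theorem for bounded domains -/

/-- The competitors in the extremal problem for the Riemann map of `U` based at `z₀`. -/
structure IsRiemannCompetitor (U : Set ℂ) (z₀ : ℂ) (f : ℂ → ℂ) : Prop where
  differentiableOn : DifferentiableOn ℂ f U
  mapsTo : MapsTo f U (ball 0 1)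
  injOn : InjOn f U
  map_base : f z₀ = 0

theorem exists_isRiemannCompetitor {U : Set ℂ} (hb : Bornology.IsBounded U) (z₀ : ℂ) :
    ∃ f, IsRiemannCompetitor U z₀ f := by
  obtain ⟨R, hR, hUR⟩ := hb.subset_ball_lt 0 z₀
  refine ⟨fun z ↦ (z - z₀) / R, by fun_prop, fun z hz ↦ ?_, fun z _ w _ h ↦ ?_, by simp⟩
  · have := hUR hz
    rw [mem_ball, dist_eq_norm] at this
    rw [mem_ball_zero_iff, norm_div, Complex.norm_real, Real.norm_of_nonneg hR.le, div_lt_one hR]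
    exact this
  · have hR' : (R : ℂ) ≠ 0 := by exact_mod_cast hR.ne'
    simpa [div_left_inj' hR'] using h

/-- A pointwise limit of uniformly bounded holomorphic functions is a locally uniform limit. -/
theorem tendstoLocallyUniformlyOn_of_tendsto_of_norm_le {ι : Type*} {l : Filter ι} [l.NeBot]
    {U : Set ℂ} (hU : IsOpen U) {F : ι → ℂ → ℂ} {f : ℂ → ℂ}
    (hF : ∀ n, DifferentiableOn ℂ (F n) U) (hm : ∀ n, ∀ z ∈ U, ‖F n z‖ ≤ 1)
    (hlim : ∀ z ∈ U, Tendsto (F · z) l (𝓝 (f z))) : TendstoLocallyUniformlyOn F f l U := by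
  rw [Metric.tendstoLocallyUniformlyOn_iff]
  intro ε hε x hx
  obtain ⟨r, hr, hrU⟩ := Metric.isOpen_iff.1 hU x hx
  -- The Schwarz lemma gives a Lipschitz constant independent of `n`, which passes to the limit; the
  -- radius `ε * r / 8` keeps both oscillations below `ε / 4`.
  have hlip : ∀ n, ∀ y ∈ ball x r, dist (F n y) (F n x) ≤ 2 / r * dist y x := by
    intro n y hy
    refine Complex.dist_le_div_mul_dist_of_mapsTo_ball ((hF n).mono hrU) (fun z hz ↦ ?_) hy
    rw [mem_closedBall]
    exact (dist_le_norm_add_norm _ _).trans (by linarith [hm n z (hrU hz), hm n x hx])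
  have hlipf : ∀ y ∈ ball x r, dist (f y) (f x) ≤ 2 / r * dist y x := fun y hy ↦
    le_of_tendsto ((hlim y (hrU hy)).dist (hlim x hx)) (Eventually.of_forall fun n ↦ hlip n y hy)
  have hρ : 0 < min r (ε * r / 8) := by positivity
  refine ⟨ball x (min r (ε * r / 8)), mem_nhdsWithin_of_mem_nhds (ball_mem_nhds x hρ), ?_⟩
  filter_upwards [(hlim x hx).eventually (ball_mem_nhds _ (by positivity : 0 < ε / 4))]
    with n hn y hy
  have hyr : y ∈ ball x r := ball_subset_ball (min_le_left _ _) hy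
  have hy8 : dist y x < ε * r / 8 := lt_of_lt_of_le hy (min_le_right _ _)
  have h4 : 2 / r * dist y x < ε / 4 := by
    calc 2 / r * dist y x < 2 / r * (ε * r / 8) := by gcongr
      _ = ε / 4 := by field_simp; norm_num
  have h1 := hlip n y hyr
  have h2 := hlipf y hyr
  have h3 : dist (f y) (F n y) ≤ dist (f y) (f x) + dist (f x) (F n x) + dist (F n x) (F n y) :=
    dist_triangle4 _ _ _ _
  rw [dist_comm (f x), dist_comm (F n x) (F n y)] at h3
  linarith

/-- **Hurwitz's theorem**: a nonconstant locally uniform limit of injective holomorphic functions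
is injective. -/
theorem injOn_of_tendstoLocallyUniformlyOn {ι : Type*} {l : Filter ι} [l.NeBot]
    {U : Set ℂ} (hU : IsOpen U) (hc : IsPreconnected U) {F : ι → ℂ → ℂ} {f : ℂ → ℂ}
    (hF : ∀ n, DifferentiableOn ℂ (F n) U) (hi : ∀ n, InjOn (F n) U)
    (hlim : TendstoLocallyUniformlyOn F f l U) (hne : ∃ z ∈ U, deriv f z ≠ 0) : InjOn f U := by
  have hf : DifferentiableOn ℂ f U := hlim.differentiableOn (Eventually.of_forall hF) hU
  intro a ha b hb hab
  by_contra hne'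
  have hnc : ∀ᶠ z in 𝓝[≠] a, f z - f a ≠ 0 := by
    have han : AnalyticOnNhd ℂ (fun z ↦ f z - f a) U := (hf.sub_const _).analyticOnNhd hU
    refine (han a ha).eventually_eq_zero_or_eventually_ne_zero.resolve_left fun h ↦ ?_
    obtain ⟨z, hz, hdz⟩ := hne
    have hE := han.eqOn_zero_of_preconnected_of_eventuallyEq_zero hc ha h
    refine hdz ?_
    have : f =ᶠ[𝓝 z] fun _ ↦ f a := by
      filter_upwards [hU.mem_nhds hz] with w hw using sub_eq_zero.1 (hE hw)
    rw [this.deriv_eq]; simp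
  have hev : ∀ᶠ z in 𝓝 a, z ∈ U ∧ z ≠ b ∧ (z ≠ a → f z - f a ≠ 0) :=
    (hU.eventually_mem ha).and
      ((isOpen_ne.eventually_mem hne').and (eventually_nhdsWithin_iff.1 hnc))
  obtain ⟨r, hr, hrs⟩ := (nhds_basis_closedBall.eventually_iff).1 hev
  have hsub : closedBall a r ⊆ U := fun z hz ↦ (hrs hz).1
  obtain ⟨ε, hε, hεs⟩ : ∃ ε > 0, ∀ z ∈ sphere a r, ε ≤ ‖f z - f a‖ := by
    obtain ⟨w, hw, hmin⟩ := (isCompact_sphere a r).exists_isMinOn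
      (NormedSpace.sphere_nonempty.2 hr.le)
      ((hf.continuousOn.mono (sphere_subset_closedBall.trans hsub)).sub continuousOn_const).norm
    refine ⟨‖f w - f a‖, ?_, fun z hz ↦ hmin hz⟩
    exact norm_pos_iff.2 ((hrs (sphere_subset_closedBall hw)).2.2 (ne_of_mem_sphere hw hr.ne'))
  have hunif : TendstoUniformlyOn F f l (closedBall a r) :=
    (tendstoLocallyUniformlyOn_iff_forall_isCompact hU).1 hlim _ hsub (isCompact_closedBall a r)
  have hb' : Tendsto (F · b) l (𝓝 (f b)) := hlim.tendsto_at hb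
  have ha' : Tendsto (F · a) l (𝓝 (f a)) := hlim.tendsto_at ha
  have hab' : Tendsto (fun n ↦ dist (F n b) (F n a)) l (𝓝 0) := by
    have := hb'.dist ha'
    rwa [hab, dist_self] at this
  obtain ⟨n, hn1, hn2⟩ := ((Metric.tendstoUniformlyOn_iff.1 hunif (ε / 4) (by positivity)).and
    (hab'.eventually (gt_mem_nhds (by positivity : 0 < ε / 4)))).exists
  -- A quantitative open mapping theorem takes the place of the argument principle. On the circle `F
  -- n` stays `ε / 2` away from `F n a`, so the image covers a ball around `F n a` that already
  -- contains `F n b`, although `b` is outside the closed disc.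
  have hball : ball (F n a) ((ε / 2) / 2) ⊆ F n '' closedBall a r := by
    refine DiffContOnCl.ball_subset_image_closedBall ?_ hr (fun z hz ↦ ?_) ?_
    · exact ((hF n).mono hsub).diffContOnCl_ball subset_rfl
    · have h1 := hn1 z (sphere_subset_closedBall hz)
      have h2 := hn1 a (mem_closedBall_self hr.le)
      have h3 := hεs z hz
      have h4 := dist_triangle4 (f z) (F n z) (F n a) (f a)
      rw [dist_comm (F n a) (f a)] at h4
      rw [← dist_eq_norm] at h3 ⊢
      linarith
    · refine Eventually.frequently (f := 𝓝[≠] a) ?_ |>.filter_mono nhdsWithin_le_nhds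
      filter_upwards [self_mem_nhdsWithin, nhdsWithin_le_nhds (hU.mem_nhds ha)] with z hz hzU h
      exact hz (hi n hzU ha h)
  have hmem : F n b ∈ ball (F n a) ((ε / 2) / 2) := by rw [mem_ball]; linarith
  obtain ⟨z, hz, hzb⟩ := hball hmem
  exact (hrs hz).2.1 (hi n (hsub hz) hb hzb)

/-- Montel's theorem is replaced by a limit along an ultrafilter: pointwise limits exist by
compactness of the closed disc, and uniform boundedness makes them locally uniform. The limit is
injective by Hurwitz, since its derivative at `z₀` is at least that of some competitor and hence
nonzero. -/
theorem exists_extremal_isRiemannCompetitor {U : Set ℂ} (hU : IsOpen U) (hc : IsPreconnected U)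
    (hb : Bornology.IsBounded U) {z₀ : ℂ} (hz₀ : z₀ ∈ U) :
    ∃ f, IsRiemannCompetitor U z₀ f ∧
      ∀ g, IsRiemannCompetitor U z₀ g → ‖deriv g z₀‖ ≤ ‖deriv f z₀‖ := by
  set S : Set ℝ := {t | ∃ f, IsRiemannCompetitor U z₀ f ∧ ‖deriv f z₀‖ = t}
  obtain ⟨r, hr, hrU⟩ := Metric.isOpen_iff.1 hU z₀ hz₀
  obtain ⟨f₀, hf₀⟩ := exists_isRiemannCompetitor hb z₀
  have hSne : S.Nonempty := ⟨_, f₀, hf₀, rfl⟩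
  have hSb : BddAbove S := by
    refine ⟨1 / r, ?_⟩
    rintro _ ⟨f, hf, rfl⟩
    refine Complex.norm_deriv_le_div_of_mapsTo_ball (hf.differentiableOn.mono hrU)
      (fun z hz ↦ ?_) hr
    rw [hf.map_base]
    exact ball_subset_closedBall (hf.mapsTo (hrU hz))
  obtain ⟨u, -, hu, huS⟩ := exists_seq_tendsto_sSup hSne hSb
  choose F hF hFu using huS
  set l : Ultrafilter ℕ := Ultrafilter.of atTop
  have hl : (l : Filter ℕ) ≤ atTop := Ultrafilter.of_le _
  have hlim : ∀ z ∈ U, ∃ y, Tendsto (F · z) l (𝓝 y) := by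
    intro z hz
    obtain ⟨y, -, hy⟩ := (isCompact_closedBall (0 : ℂ) 1).ultrafilter_le_nhds (l.map (F · z))
      (by
        rw [Ultrafilter.coe_map, le_principal_iff, mem_map]
        exact univ_mem' fun n ↦ ball_subset_closedBall ((hF n).mapsTo hz))
    exact ⟨y, hy⟩
  choose! f hf using hlim
  have hmF : ∀ n, ∀ z ∈ U, ‖F n z‖ ≤ 1 := fun n z hz ↦ by
    simpa using ball_subset_closedBall ((hF n).mapsTo hz)
  have hunif : TendstoLocallyUniformlyOn F f l U :=
    tendstoLocallyUniformlyOn_of_tendsto_of_norm_le hU (fun n ↦ (hF n).differentiableOn) hmF hf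
  have hdF : ∀ᶠ n in (l : Filter ℕ), DifferentiableOn ℂ (F n) U :=
    Eventually.of_forall fun n ↦ (hF n).differentiableOn
  have hd : Tendsto (fun n ↦ ‖deriv (F n) z₀‖) l (𝓝 ‖deriv f z₀‖) :=
    ((hunif.deriv hdF hU).tendsto_at hz₀).norm
  have hsup : ‖deriv f z₀‖ = sSup S := by
    refine tendsto_nhds_unique hd ?_
    simp only [hFu]
    exact hu.mono_left hl
  have hmax : ∀ g, IsRiemannCompetitor U z₀ g → ‖deriv g z₀‖ ≤ ‖deriv f z₀‖ := fun g hg ↦ by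
    rw [hsup]; exact le_csSup hSb ⟨g, hg, rfl⟩
  have hdf : DifferentiableOn ℂ f U := hunif.differentiableOn hdF hU
  have hdne : deriv f z₀ ≠ 0 := by
    have h1 := hmax f₀ hf₀
    have h2 := hf₀.injOn.deriv_ne_zero_of_differentiableOn hU hf₀.differentiableOn hz₀
    exact norm_pos_iff.1 (lt_of_lt_of_le (norm_pos_iff.2 h2) h1)
  have hinj : InjOn f U := injOn_of_tendstoLocallyUniformlyOn hU hc
    (fun n ↦ (hF n).differentiableOn) (fun n ↦ (hF n).injOn) hunif ⟨z₀, hz₀, hdne⟩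
  have hle : ∀ z ∈ U, ‖f z‖ ≤ 1 := fun z hz ↦
    le_of_tendsto (hf z hz).norm (Eventually.of_forall fun n ↦ hmF n z hz)
  refine ⟨f, ⟨hdf, fun z hz ↦ ?_, hinj, ?_⟩, hmax⟩
  -- The limit only gives values in the closed disc; openness of the image puts them in its
  -- interior.
  · have h1 : f '' U ∈ 𝓝 (f z) :=
      hinj.nhds_le_map_of_differentiableOn hU hdf hz (image_mem_map (hU.mem_nhds hz))
    have h2 : f '' U ⊆ closedBall 0 1 := by
      rintro _ ⟨w, hw, rfl⟩
      simpa using hle w hw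
    rw [← interior_closedBall (0 : ℂ) one_ne_zero]
    exact mem_interior_iff_mem_nhds.2 (mem_of_superset h1 h2)
  · refine tendsto_nhds_unique (hf z₀ hz₀) ?_
    simp [(hF _).map_base]

/-- The **Riemann mapping theorem** for bounded simply connected domains. -/
theorem exists_riemann_map {U : Set ℂ} (hU : IsOpen U) (hsc : IsSimplyConnected U)
    (hb : Bornology.IsBounded U) {z₀ : ℂ} (hz₀ : z₀ ∈ U) :
    ∃ f, IsRiemannCompetitor U z₀ f ∧ SurjOn f U (ball 0 1) := by
  obtain ⟨f, hf, hmax⟩ := exists_extremal_isRiemannCompetitor hU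
    hsc.isPathConnected.isConnected.isPreconnected hb hz₀
  refine ⟨f, hf, fun w hw ↦ ?_⟩
  by_contra hwf
  rw [mem_ball_zero_iff] at hw
  have hf1 : ∀ z ∈ U, ‖f z‖ < 1 := fun z hz ↦ by simpa using hf.mapsTo hz
  have hfw : ∀ z ∈ U, f z ≠ w := fun z hz h ↦ hwf ⟨z, hz, h⟩
  have hw0 : w ≠ 0 := fun h ↦ hfw z₀ hz₀ (by rw [hf.map_base, h])
  have hFd : DifferentiableOn ℂ (discMobius w ∘ f) U := fun z hz ↦
    (hasDerivAt_discMobius hw (hf1 z hz)).differentiableAt.comp_differentiableWithinAt z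
      (hf.differentiableOn z hz)
  obtain ⟨l, hld, hl⟩ := hsc.exists_differentiableOn_exp_eq hU hFd
    (fun z hz h ↦ hfw z hz ((discMobius_eq_zero hw (hf1 z hz)).1 h))
  -- Koebe's trick: a square root of `discMobius w ∘ f`, which has no zeros because `w` is omitted.
  -- Recentred at `g z₀`, it is a competitor whose derivative is larger by the factor `(1 + t²) /
  -- (2t) > 1`, where `t² = ‖w‖`.
  set g : ℂ → ℂ := fun z ↦ Complex.exp (l z / 2)
  have hg2 : ∀ z ∈ U, g z ^ 2 = discMobius w (f z) := fun z hz ↦ by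
    rw [← Complex.exp_nat_mul, ← Function.comp_apply (f := discMobius w), ← hl z hz]
    congr 1
    push_cast; ring
  have hgd : DifferentiableOn ℂ g U := (hld.div_const 2).cexp
  have hg1 : ∀ z ∈ U, ‖g z‖ < 1 := fun z hz ↦ by
    have h := norm_discMobius_lt_one hw (hf1 z hz)
    rw [← hg2 z hz, norm_pow] at h
    exact (pow_lt_one_iff_of_nonneg (norm_nonneg _) two_ne_zero).1 h
  have hginj : InjOn g U := fun z hz z' hz' h ↦ by
    refine hf.injOn hz hz' (injOn_discMobius hw (by simpa using hf1 z hz)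
      (by simpa using hf1 z' hz') ?_)
    rw [← hg2 z hz, ← hg2 z' hz', h]
  have hcomp : IsRiemannCompetitor U z₀ (discMobius (g z₀) ∘ g) := by
    refine ⟨fun z hz ↦ ?_, fun z hz ↦ ?_, fun z hz z' hz' h ↦ ?_, by simp⟩
    · exact (hasDerivAt_discMobius (hg1 z₀ hz₀) (hg1 z hz)).differentiableAt
        |>.comp_differentiableWithinAt z (hgd z hz)
    · simpa using norm_discMobius_lt_one (hg1 z₀ hz₀) (hg1 z hz)
    · exact hginj hz hz' (injOn_discMobius (hg1 z₀ hz₀) (by simpa using hg1 z hz)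
        (by simpa using hg1 z' hz') h)
  have hle := hmax _ hcomp
  have hfd := (hf.differentiableOn.differentiableAt (hU.mem_nhds hz₀)).hasDerivAt
  have hgd₀ := (hgd.differentiableAt (hU.mem_nhds hz₀)).hasDerivAt
  set t : ℝ := ‖g z₀‖ with ht
  have hgw : g z₀ ^ 2 = -w := by rw [hg2 z₀ hz₀, hf.map_base]; simp [discMobius]
  have htw : t ^ 2 = ‖w‖ := by rw [ht, ← norm_pow, hgw, norm_neg]
  have ht1 : t < 1 := hg1 z₀ hz₀
  have ht0 : 0 < t := by
    rw [ht, norm_pos_iff]; intro h; rw [h] at hgw; simp at hgw; exact hw0 hgw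
  have hsq : 2 * g z₀ * deriv g z₀ = (1 - conj w * w) * deriv f z₀ := by
    have h1 := hgd₀.pow 2
    have h2 := (hasDerivAt_discMobius hw (hf1 z₀ hz₀)).comp z₀ hfd
    have h3 := (h2.congr_of_eventuallyEq (f₁ := g ^ 2) (by
      filter_upwards [hU.mem_nhds hz₀] with z hz using hg2 z hz)).unique h1
    rw [hf.map_base] at h3
    simp at h3
    rw [← h3]
  have hnorm : 2 * t * ‖deriv g z₀‖ = (1 - t ^ 4) * ‖deriv f z₀‖ := by
    have h := congrArg norm hsq
    have h4 : 0 ≤ 1 - ‖w‖ ^ 2 := by nlinarith [norm_nonneg w]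
    rw [one_sub_conj_mul_self, norm_mul, norm_mul, norm_mul, Complex.norm_real,
      Real.norm_of_nonneg h4, ← htw] at h
    rw [← ht] at h
    simp only [Complex.norm_ofNat] at h
    rw [h]; ring
  have hh := (hasDerivAt_discMobius (hg1 z₀ hz₀) (hg1 z₀ hz₀)).comp z₀ hgd₀
  have hpos : 0 < 1 - t ^ 2 := by nlinarith
  have hhn : ‖deriv (discMobius (g z₀) ∘ g) z₀‖ = ‖deriv g z₀‖ / (1 - t ^ 2) := by
    rw [hh.deriv, one_sub_conj_mul_self, norm_mul, norm_div, norm_pow, Complex.norm_real, ← ht,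
      Real.norm_of_nonneg hpos.le]
    field_simp
  rw [hhn, div_le_iff₀ hpos] at hle
  have hfpos : 0 < ‖deriv f z₀‖ := norm_pos_iff.2
    (hf.injOn.deriv_ne_zero_of_differentiableOn hU hf.differentiableOn hz₀)
  have h5 : (1 - t ^ 4) * ‖deriv f z₀‖ ≤ 2 * t * (‖deriv f z₀‖ * (1 - t ^ 2)) := by
    rw [← hnorm]; gcongr
  have h6 : 0 < ‖deriv f z₀‖ * (1 - t ^ 2) * (1 - t) ^ 2 := by
    have : 0 < (1 - t) ^ 2 := by nlinarith
    positivity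
  nlinarith

/-! ### The distance to the boundary -/

section BdryDist

variable {Ω : Set ℂ}

theorem frontier_nonempty_of_isBounded (hb : Bornology.IsBounded Ω) (hne : Ω.Nonempty) :
    (frontier Ω).Nonempty := by
  rw [nonempty_frontier_iff]
  exact ⟨hne, fun h ↦ NormedSpace.unbounded_univ ℂ ℂ (h ▸ hb)⟩

theorem exists_dist_eq_bdryDist (hb : Bornology.IsBounded Ω) {z : ℂ} (hz : z ∈ Ω) :
    ∃ b ∈ frontier Ω, bdryDist Ω z = dist z b :=
  isClosed_frontier.exists_infDist_eq_dist (frontier_nonempty_of_isBounded hb ⟨z, hz⟩) z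

theorem bdryDist_pos (hΩ : IsOpen Ω) (hb : Bornology.IsBounded Ω) {z : ℂ} (hz : z ∈ Ω) :
    0 < bdryDist Ω z := by
  refine (isClosed_frontier.notMem_iff_infDist_pos
    (frontier_nonempty_of_isBounded hb ⟨z, hz⟩)).1 fun h ↦ ?_
  rw [hΩ.frontier_eq] at h
  exact h.2 hz

theorem bdryDist_le_add_dist (z w : ℂ) : bdryDist Ω z ≤ bdryDist Ω w + dist z w :=
  infDist_le_infDist_add_dist

/-- The ball is connected and misses the frontier, so it cannot leave `Ω`. -/
theorem ball_bdryDist_subset (hΩ : IsOpen Ω) {z : ℂ} (hz : z ∈ Ω) : ball z (bdryDist Ω z) ⊆ Ω := by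
  rcases le_or_gt (bdryDist Ω z) 0 with h | hr
  · rw [ball_eq_empty.2 h]; exact empty_subset _
  refine (convex_ball z _).isPreconnected.subset_left_of_subset_union (v := (closure Ω)ᶜ) hΩ
    isClosed_closure.isOpen_compl (disjoint_compl_right.mono_left subset_closure) ?_
    ⟨z, mem_ball_self hr, hz⟩
  intro x hx
  by_contra hxu
  rw [mem_union, mem_compl_iff, not_or, not_not] at hxu
  have hxf : x ∈ frontier Ω := by rw [hΩ.frontier_eq]; exact ⟨hxu.2, hxu.1⟩
  have h1 : bdryDist Ω z ≤ dist z x := infDist_le_dist_of_mem hxf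
  rw [mem_ball, dist_comm] at hx
  linarith

theorem continuous_bdryDist : Continuous (bdryDist Ω) := continuous_infDist_pt _

/-- Comparability of the boundary distances of two points whose distance is at most half of
the boundary distance of the first one. -/
theorem bdryDist_le_two_mul_of_dist_le {z w : ℂ} (h : dist z w ≤ bdryDist Ω z / 2) :
    bdryDist Ω z ≤ 2 * bdryDist Ω w ∧ bdryDist Ω w ≤ 3 / 2 * bdryDist Ω z := by
  have h1 := bdryDist_le_add_dist (Ω := Ω) z w
  have h2 := bdryDist_le_add_dist (Ω := Ω) w z
  rw [dist_comm] at h2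
  constructor <;> linarith

end BdryDist

/-! ### Distortion estimates for the Riemann map -/

/-- A continuous branch of the square root on a disc stays away from the antipode of its
central value. -/
theorem norm_le_norm_add_of_sq_eq {G : ℂ → ℂ} {z b : ℂ} (hzb : z ≠ b)
    (hG : ContinuousOn G (ball z (dist z b))) (hG2 : ∀ w ∈ ball z (dist z b), G w ^ 2 = w - b)
    {w : ℂ} (hw : w ∈ ball z (dist z b)) : ‖G z‖ ≤ ‖G w + G z‖ := by
  have hr : 0 < dist z b := dist_pos.2 hzb
  have hzm := mem_ball_self (x := z) hr
  have hGz : G z ≠ 0 := fun h ↦ by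
    have := hG2 z hzm
    rw [h] at this
    simp at this
    exact hzb (sub_eq_zero.1 this.symm)
  -- The square of `G x / G z` is `1 + (x - z) / (z - b)`, which has positive real part; hence the
  -- quotient is never purely imaginary and, starting from `1`, stays in the right half-plane.
  have hne : ∀ x ∈ ball z (dist z b), (G x / G z).re ≠ 0 := by
    intro x hx h
    have h1 : (G x / G z) ^ 2 = 1 + (x - z) / (z - b) := by
      rw [div_pow, hG2 x hx, hG2 z hzm]
      field_simp [sub_ne_zero.2 hzb]
      ring
    have h2 : ‖(x - z) / (z - b)‖ < 1 := by
      rw [norm_div, ← dist_eq_norm, ← dist_eq_norm, div_lt_one hr]; exact hx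
    have h3 : 0 < ((G x / G z) ^ 2).re := by
      rw [h1, Complex.add_re, Complex.one_re]
      have := (abs_lt.1 (lt_of_le_of_lt (Complex.abs_re_le_norm _) h2)).1
      linarith
    rw [sq, Complex.mul_re, h] at h3
    nlinarith [mul_self_nonneg (G x / G z).im]
  have hpos : 0 < (G w / G z).re := by
    by_contra hle
    have hp : IsPreconnected (ball z (dist z b)) := (convex_ball _ _).isPreconnected
    have hc : ContinuousOn (fun x ↦ (G x / G z).re) (ball z (dist z b)) :=
      Complex.continuous_re.comp_continuousOn (hG.div_const _)
    obtain ⟨x, hx, hx0⟩ := hp.intermediate_value hw hzm hc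
      (show (0 : ℝ) ∈ Icc _ _ from ⟨not_lt.1 hle, by simp [div_self hGz]⟩)
    exact hne x hx hx0
  have h4 : G w + G z = (G w / G z + 1) * G z := by field_simp
  rw [h4, norm_mul]
  have h5 : 1 ≤ ‖G w / G z + 1‖ := by
    refine le_trans ?_ (Complex.re_le_norm _)
    simp only [Complex.add_re, Complex.one_re]
    linarith
  nlinarith [norm_nonneg (G z)]

/-- A weak form of the **Koebe quarter theorem**. -/
theorem one_sub_norm_le_mul_bdryDist {Ω : Set ℂ} (hΩ : IsOpen Ω) (hb : Bornology.IsBounded Ω)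
    (hsc : IsSimplyConnected Ω) {ψ : ℂ → ℂ} (hd : DifferentiableOn ℂ ψ Ω)
    (hm : MapsTo ψ Ω (ball 0 1)) (hi : InjOn ψ Ω) (hs : SurjOn ψ Ω (ball 0 1))
    {z : ℂ} (hz : z ∈ Ω) :
    1 - ‖ψ z‖ ≤ 48 * (‖deriv ψ z‖ * bdryDist Ω z) := by
  obtain ⟨b, hbf, hzb⟩ := exists_dist_eq_bdryDist hb hz
  have hbΩ : b ∉ Ω := by rw [hΩ.frontier_eq] at hbf; exact hbf.2
  have hδ := bdryDist_pos hΩ hb hz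
  have hsub := ball_bdryDist_subset hΩ hz
  rw [hzb] at hδ hsub ⊢
  have hne : z ≠ b := dist_pos.1 hδ
  obtain ⟨l, hld, hl⟩ := hsc.exists_differentiableOn_exp_eq hΩ
    (F := fun w ↦ w - b) (by fun_prop) (fun w hw h ↦ hbΩ (sub_eq_zero.1 h ▸ hw))
  set G : ℂ → ℂ := fun w ↦ Complex.exp (l w / 2)
  have hGd : DifferentiableOn ℂ G Ω := (hld.div_const 2).cexp
  have hG2 : ∀ w ∈ Ω, G w ^ 2 = w - b := fun w hw ↦ by
    rw [← Complex.exp_nat_mul, ← hl w hw]; congr 1; push_cast; ring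
  have hGz : G z ≠ 0 := Complex.exp_ne_zero _
  have hu : 0 < ‖G z‖ := norm_pos_iff.2 hGz
  have hu2 : ‖G z‖ ^ 2 = dist z b := by rw [← norm_pow, hG2 z hz, dist_eq_norm]
  -- The root `G` keeps away from `-G z`. Outside the disc, `‖G w + G z‖ * ‖G w - G z‖ ≥ ‖G z‖²`,
  -- and a first factor below `‖G z‖ / 3` would force the product below `7/9 * ‖G z‖²`.
  have hlow : ∀ w ∈ Ω, ‖G z‖ / 3 ≤ ‖G w + G z‖ := by
    intro w hw
    by_cases hwb : w ∈ ball z (dist z b)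
    · have := norm_le_norm_add_of_sq_eq hne (hGd.continuousOn.mono hsub)
        (fun x hx ↦ hG2 x (hsub hx)) hwb
      linarith
    · rw [mem_ball, not_lt, ← hu2, dist_eq_norm] at hwb
      have h1 : w - z = (G w + G z) * (G w - G z) := by
        linear_combination hG2 z hz - hG2 w hw
      rw [h1, norm_mul] at hwb
      by_contra hlt
      rw [not_le] at hlt
      have h2 : ‖G w - G z‖ ≤ ‖G w + G z‖ + 2 * ‖G z‖ := by
        have h3 : G w - G z = (G w + G z) - 2 * G z := by ring
        rw [h3]
        refine (norm_sub_le _ _).trans ?_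
        rw [norm_mul]; simp
      nlinarith [norm_nonneg (G w + G z), norm_nonneg (G w - G z)]
  set H : ℂ → ℂ := fun w ↦ (G w + G z)⁻¹
  have hHne : ∀ w ∈ Ω, G w + G z ≠ 0 := fun w hw ↦
    norm_pos_iff.1 (lt_of_lt_of_le (by positivity) (hlow w hw))
  set g := Function.invFunOn ψ Ω
  have hgm : ∀ y ∈ ball (0 : ℂ) 1, g y ∈ Ω := fun y hy ↦ (Function.invFunOn_mem (hs hy) :)
  have hψz : ‖ψ z‖ < 1 := by simpa using hm hz
  have hrpos : 0 < 1 - ‖ψ z‖ := by linarith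
  have hball : ball (ψ z) (1 - ‖ψ z‖) ⊆ ball 0 1 := by
    refine ball_subset_ball' ?_
    rw [dist_zero_right]; linarith
  have hgd : ∀ y ∈ ball (0 : ℂ) 1, DifferentiableAt ℂ g y := by
    intro y hy
    obtain ⟨x, hx, rfl⟩ := hs hy
    exact (hi.hasDerivAt_invFunOn hΩ hd hx).differentiableAt
  have hHd : ∀ w ∈ Ω, DifferentiableAt ℂ H w := fun w hw ↦
    ((hGd.differentiableAt (hΩ.mem_nhds hw)).add_const _).inv (hHne w hw)
  have hHle : ∀ w ∈ Ω, ‖H w‖ ≤ 3 / ‖G z‖ := fun w hw ↦ by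
    rw [norm_inv, inv_le_comm₀ (norm_pos_iff.2 (hHne w hw)) (by positivity), inv_div]
    exact hlow w hw
  -- `H` is bounded by `3 / ‖G z‖`, so it oscillates by at most `6 / ‖G z‖`. The exact derivative
  -- has modulus `1 / (8 ‖G z‖³ ‖ψ' z‖)`, and `6 * 8 = 48`.
  have hcau : ‖deriv (H ∘ g) (ψ z)‖ ≤ (6 / ‖G z‖) / (1 - ‖ψ z‖) := by
    refine Complex.norm_deriv_le_div_of_mapsTo_ball (fun y hy ↦ ?_) (fun y hy ↦ ?_) hrpos
    · have hgy := hgm y (hball hy)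
      exact ((hHd _ hgy).comp y (hgd y (hball hy))).differentiableWithinAt
    · rw [mem_closedBall]
      refine (dist_le_norm_add_norm _ _).trans ?_
      have h1 := hHle _ (hgm y (hball hy))
      have h2 := hHle _ (hgm _ (hm hz))
      simp only [Function.comp_apply]
      calc _ ≤ 3 / ‖G z‖ + 3 / ‖G z‖ := add_le_add h1 h2
        _ = 6 / ‖G z‖ := by ring
  have hψ0 := hi.deriv_ne_zero_of_differentiableOn hΩ hd hz
  have hG' : 2 * G z * deriv G z = 1 := by
    have h1 := (hGd.differentiableAt (hΩ.mem_nhds hz)).hasDerivAt.pow 2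
    have h2 := (((hasDerivAt_id z).sub_const b).congr_of_eventuallyEq (f₁ := G ^ 2) (by
      filter_upwards [hΩ.mem_nhds hz] with w hw using hG2 w hw)).unique h1
    simp at h2
    exact h2.symm
  have hH' : HasDerivAt H (-deriv G z / (G z + G z) ^ 2) z :=
    ((hGd.differentiableAt (hΩ.mem_nhds hz)).hasDerivAt.add_const _).inv (hHne z hz)
  have hgz : g (ψ z) = z := hi.leftInvOn_invFunOn hz
  have hder : HasDerivAt (H ∘ g) (-deriv G z / (G z + G z) ^ 2 * (deriv ψ z)⁻¹) (ψ z) := by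
    refine HasDerivAt.comp _ ?_ (hi.hasDerivAt_invFunOn hΩ hd hz)
    rwa [hgz]
  have hGn : ‖deriv G z‖ = 1 / (2 * ‖G z‖) := by
    have h := congrArg norm hG'
    rw [norm_mul, norm_mul] at h
    simp only [Complex.norm_ofNat, norm_one] at h
    rw [eq_div_iff (by positivity)]
    linarith
  have hψn : 0 < ‖deriv ψ z‖ := norm_pos_iff.2 hψ0
  rw [hder.deriv, ← two_mul, norm_mul, norm_div, norm_neg, norm_pow, norm_mul, norm_inv, hGn,
    Complex.norm_ofNat, le_div_iff₀ hrpos] at hcau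
  rw [← hu2]
  have h7 : 1 / (2 * ‖G z‖) / (2 * ‖G z‖) ^ 2 * ‖deriv ψ z‖⁻¹ * (1 - ‖ψ z‖) =
      (1 - ‖ψ z‖) / (8 * ‖G z‖ ^ 3 * ‖deriv ψ z‖) := by
    field_simp; norm_num
  rw [h7, div_le_div_iff₀ (by positivity) hu] at hcau
  refine le_of_mul_le_mul_right ?_ hu
  linarith

/-- The derivative of the Riemann map is comparable to the reciprocal of the boundary distance
on Whitney discs around the base point. -/
theorem one_le_mul_norm_deriv_riemann_map {Ω : Set ℂ} (hΩ : IsOpen Ω)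
    (hb : Bornology.IsBounded Ω) (hsc : IsSimplyConnected Ω) {z₀ : ℂ} (hz₀ : z₀ ∈ Ω) {ψ : ℂ → ℂ}
    (hψ : IsRiemannCompetitor Ω z₀ ψ) (hs : SurjOn ψ Ω (ball 0 1)) {w : ℂ}
    (hw : w ∈ ball z₀ (bdryDist Ω z₀ / 2)) : 1 ≤ 144 * bdryDist Ω z₀ * ‖deriv ψ w‖ := by
  have hδ := bdryDist_pos hΩ hb hz₀
  have hwδ : w ∈ ball z₀ (bdryDist Ω z₀) := ball_subset_ball (by linarith) hw
  have hwΩ := ball_bdryDist_subset hΩ hz₀ hwδ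
  rw [mem_ball, dist_comm] at hw
  -- Schwarz lemma on the full ball of radius `δ(z₀)`. With `δ(w) ≤ 3/2 δ(z₀)` the Koebe bound then
  -- gives `2 * 48 * 3/2 = 144`.
  have h1 : ‖ψ w‖ ≤ 1 / 2 := by
    have h := Complex.dist_le_div_mul_dist_of_mapsTo_ball (f := ψ) (c := z₀)
      (R₁ := bdryDist Ω z₀) (R₂ := 1) (hψ.differentiableOn.mono (ball_bdryDist_subset hΩ hz₀))
      (fun y hy ↦ by
        rw [hψ.map_base]
        exact ball_subset_closedBall (hψ.mapsTo (ball_bdryDist_subset hΩ hz₀ hy))) hwδ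
    rw [hψ.map_base, dist_zero_right, dist_comm] at h
    refine h.trans ?_
    rw [div_mul_eq_mul_div, one_mul, div_le_iff₀ hδ]
    linarith
  have h2 := one_sub_norm_le_mul_bdryDist hΩ hb hsc hψ.differentiableOn hψ.mapsTo hψ.injOn hs hwΩ
  have h3 := (bdryDist_le_two_mul_of_dist_le hw.le).2
  nlinarith [norm_nonneg (deriv ψ w)]

/-! ### The test functions -/

/-- In polar coordinates this reduces to integrability of `(1 - y)^α` at `y = 1`, which is what `α >
-1` provides. -/
theorem lintegral_ball_one_sub_norm_rpow_lt_top {α : ℝ} (hα : -1 < α) :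
    ∫⁻ w in ball (0 : ℂ) 1, ENNReal.ofReal ((1 - ‖w‖) ^ α) < ∞ := by
  have h1 : IntegrableOn (fun y : ℝ ↦ (1 - y) ^ α) (Ioo 0 1) := by
    have h := (intervalIntegral.intervalIntegrable_rpow' (a := 0) (b := 1) hα).comp_sub_left 1
    simp only [sub_zero, sub_self] at h
    exact ((intervalIntegrable_iff_integrableOn_Ioo_of_le zero_le_one).1 h.symm)
  have h2 : IntegrableOn (fun y : ℝ ↦ y ^ (Module.finrank ℝ ℂ - 1) • (1 - y) ^ α) (Ioo 0 1) := by
    refine h1.mono' ?_ ?_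
    · exact ((continuous_pow _).aestronglyMeasurable).smul h1.aestronglyMeasurable
    · filter_upwards [ae_restrict_mem measurableSet_Ioo] with y hy
      rw [norm_smul, Real.norm_of_nonneg (by positivity [hy.1.le]),
        Real.norm_of_nonneg (Real.rpow_nonneg (by linarith [hy.2]) _)]
      refine mul_le_of_le_one_left (Real.rpow_nonneg (by linarith [hy.2]) _) ?_
      exact pow_le_one₀ hy.1.le hy.2.le
  have h3 := ((integrableOn_fun_norm_addHaar (E := ℂ) (μ := volume)).2 h2).2
  rw [hasFiniteIntegral_iff_ofReal] at h3
  · exact h3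
  · filter_upwards [ae_restrict_mem measurableSet_ball] with w hw
    rw [mem_ball_zero_iff] at hw
    exact Real.rpow_nonneg (by linarith) _

/-- Two-sided bounds between positive reals give a bound between their real powers. -/
theorem Real.rpow_le_rpow_abs_mul_rpow {x y c : ℝ} (hx : 0 < x) (hy : 0 < y) (hc : 0 < c)
    (hxy : x ≤ c * y) (hyx : y ≤ c * x) (α : ℝ) : x ^ α ≤ c ^ |α| * y ^ α := by
  rcases le_or_gt 0 α with h | h
  · rw [abs_of_nonneg h, ← Real.mul_rpow hc.le hy.le]
    exact Real.rpow_le_rpow hx.le hxy h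
  · rw [abs_of_neg h, Real.rpow_neg hc.le, ← div_eq_inv_mul, le_div_iff₀ (by positivity),
      mul_comm, ← Real.mul_rpow hc.le hx.le]
    exact Real.rpow_le_rpow_of_nonpos hy hyx h.le

theorem det_restrictScalars_fderiv (f : ℂ → ℂ) (z : ℂ) :
    (ContinuousLinearMap.restrictScalars ℝ (fderiv ℂ f z)).det = ‖deriv f z‖ ^ 2 := by
  rw [ContinuousLinearMap.det, ← LinearMap.det_toMatrix Complex.basisOneI, Matrix.det_fin_two]
  have h (w : ℂ) : fderiv ℂ f z w = w * deriv f z := by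
    rw [← fderiv_apply_one_eq_deriv, ← smul_eq_mul, ← map_smul, smul_eq_mul, mul_one]
  simp only [LinearMap.toMatrix_apply, Complex.coe_basisOneI, Complex.coe_basisOneI_repr,
    ContinuousLinearMap.coe_coe, ContinuousLinearMap.coe_restrictScalars', h]
  rw [← Complex.normSq_eq_norm_sq, Complex.normSq_apply]
  simp

/-- For a Riemann map `ψ` the function `|ψ'|^(2+α) δ^α` has an integral bounded independently of
the domain and of the base point. -/
theorem lintegral_norm_deriv_rpow_mul_bdryDist_rpow_le {Ω : Set ℂ} (hΩ : IsOpen Ω)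
    (hb : Bornology.IsBounded Ω) (hsc : IsSimplyConnected Ω) {z₀ : ℂ} {ψ : ℂ → ℂ}
    (hψ : IsRiemannCompetitor Ω z₀ ψ) (hs : SurjOn ψ Ω (ball 0 1)) (α : ℝ) :
    ∫⁻ z in Ω, ENNReal.ofReal (‖deriv ψ z‖ ^ (2 + α) * bdryDist Ω z ^ α) ≤
      ENNReal.ofReal (48 ^ |α|) * ∫⁻ w in ball (0 : ℂ) 1, ENNReal.ofReal ((1 - ‖w‖) ^ α) := by
  have himg : ψ '' Ω = ball 0 1 := (hψ.mapsTo.image_subset).antisymm hs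
  have hcov := lintegral_image_eq_lintegral_abs_det_fderiv_mul volume hΩ.measurableSet
    (fun z hz ↦ ((hψ.differentiableOn.differentiableAt
      (hΩ.mem_nhds hz)).hasFDerivAt.restrictScalars ℝ).hasFDerivWithinAt) hψ.injOn
    (fun w ↦ ENNReal.ofReal ((1 - ‖w‖) ^ α))
  rw [← himg, hcov, ← lintegral_const_mul' _ _ ENNReal.ofReal_ne_top]
  refine setLIntegral_mono_ae' hΩ.measurableSet (ae_of_all _ fun z hz ↦ ?_)
  have hψz : ‖ψ z‖ < 1 := by simpa using hψ.mapsTo hz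
  have hδ := bdryDist_pos hΩ hb hz
  have hd : 0 < ‖deriv ψ z‖ :=
    norm_pos_iff.2 (hψ.injOn.deriv_ne_zero_of_differentiableOn hΩ hψ.differentiableOn hz)
  -- Schwarz–Pick gives the constant `2`; it is relaxed to `48` so that one constant serves both
  -- directions of the comparison, whatever the sign of `α`.
  have hpick : ‖deriv ψ z‖ * bdryDist Ω z ≤ 48 * (1 - ‖ψ z‖) := by
    refine (norm_deriv_mul_le_one_sub_sq hδ
      (hψ.differentiableOn.mono (ball_bdryDist_subset hΩ hz))
      (hψ.mapsTo.mono_left (ball_bdryDist_subset hΩ hz))).trans ?_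
    nlinarith [norm_nonneg (ψ z)]
  have hkoebe := one_sub_norm_le_mul_bdryDist hΩ hb hsc hψ.differentiableOn hψ.mapsTo hψ.injOn
    hs hz
  have hdet : |(ContinuousLinearMap.restrictScalars ℝ (fderiv ℂ ψ z)).det| = ‖deriv ψ z‖ ^ 2 := by
    rw [det_restrictScalars_fderiv, abs_of_nonneg (by positivity)]
  rw [hdet, ← ENNReal.ofReal_mul (by positivity), ← ENNReal.ofReal_mul (by positivity)]
  refine ENNReal.ofReal_le_ofReal ?_
  -- The factor `|ψ'|²` is the Jacobian, and the rest is `(|ψ'| δ)^α`, comparable to `(1 - |ψ|)^α`.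
  rw [Real.rpow_add hd, Real.rpow_two, mul_assoc, ← Real.mul_rpow hd.le hδ.le]
  have := Real.rpow_le_rpow_abs_mul_rpow (mul_pos hd hδ) (by linarith : 0 < 1 - ‖ψ z‖)
    (by norm_num : (0 : ℝ) < 48) hpick hkoebe α
  calc _ ≤ ‖deriv ψ z‖ ^ 2 * (48 ^ |α| * (1 - ‖ψ z‖) ^ α) := by gcongr
    _ = _ := by ring

/-- The test functions for Carleson measures: `‖f z‖ = ‖ψ' z‖ ^ s` for a Riemann map `ψ`. -/
theorem exists_norm_eq_norm_deriv_rpow {Ω : Set ℂ} (hΩ : IsOpen Ω) (hsc : IsSimplyConnected Ω)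
    {ψ : ℂ → ℂ} (hd : DifferentiableOn ℂ ψ Ω) (hi : InjOn ψ Ω) (s : ℝ) :
    ∃ f : ℂ → ℂ, DifferentiableOn ℂ f Ω ∧ ∀ z ∈ Ω, ‖f z‖ = ‖deriv ψ z‖ ^ s := by
  obtain ⟨l, hld, hl⟩ := hsc.exists_differentiableOn_exp_eq hΩ (hd.deriv hΩ)
    (fun z hz ↦ hi.deriv_ne_zero_of_differentiableOn hΩ hd hz)
  refine ⟨fun z ↦ Complex.exp (s * l z), (hld.const_mul _).cexp, fun z hz ↦ ?_⟩
  rw [← hl z hz, Complex.norm_exp, Complex.norm_exp, ← Real.exp_mul, Complex.re_ofReal_mul,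
    mul_comm]

/-- Each Whitney ball gets its own test function, a power of the derivative of the Riemann map based
at the centre. Its norm is bounded uniformly in the centre, which makes `c` independent of the ball.
-/
theorem exists_measure_ball_le_of_isCarlesonMeasure {Ω : Set ℂ} (hΩ : IsOpen Ω)
    (hb : Bornology.IsBounded Ω) (hsc : IsSimplyConnected Ω) {μ : Measure ℂ} {p q α κ : ℝ}
    (hp : 0 < p) (hq : 0 < q) (hα : -1 < α) (hκ : 0 < κ)
    (hμ : IsCarlesonMeasure Ω q (bergmanSpace Ω p α) (bergmanNorm Ω p α) μ) :
    ∃ c : ℝ, 0 < c ∧ ∀ (z : ℂ) (r : ℝ), IsWhitneyBall κ Ω z r →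
      μ (ball z r) ≤ ENNReal.ofReal (c * r ^ ((2 + α) * q / p)) := by
  obtain ⟨K, hK, hKf⟩ := hμ
  set D : ℝ≥0∞ := ENNReal.ofReal (48 ^ |α|) *
    ∫⁻ w in ball (0 : ℂ) 1, ENNReal.ofReal ((1 - ‖w‖) ^ α)
  have hD : D ≠ ∞ :=
    ENNReal.mul_ne_top ENNReal.ofReal_ne_top (lintegral_ball_one_sub_norm_rpow_lt_top hα).ne
  -- The added `1` only makes `E`, and hence `c`, visibly positive.
  set E : ℝ := D.toReal + 1
  have hE : 0 < E := by positivity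
  have hDE : D ≤ ENNReal.ofReal E := by
    rw [ENNReal.le_ofReal_iff_toReal_le hD hE.le]; simp [E]
  set s : ℝ := (2 + α) / p with hs_def
  refine ⟨(K * E ^ (1 / p)) ^ q * (144 / κ) ^ (s * q), by positivity, fun z r hW ↦ ?_⟩
  have hz := hW.mem
  have hδ := bdryDist_pos hΩ hb hz
  have hr : 0 < r := lt_of_lt_of_le (mul_pos hκ hδ) hW.lower
  obtain ⟨ψ, hψ, hs⟩ := exists_riemann_map hΩ hsc hb hz
  obtain ⟨f, hfd, hf⟩ := exists_norm_eq_norm_deriv_rpow hΩ hsc hψ.differentiableOn hψ.injOn s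
  have hint : ∫⁻ z in Ω, ENNReal.ofReal (‖f z‖ ^ p * bdryDist Ω z ^ α) ≤ D := by
    refine le_trans (le_of_eq ?_)
      (lintegral_norm_deriv_rpow_mul_bdryDist_rpow_le hΩ hb hsc hψ hs α)
    refine setLIntegral_congr_fun hΩ.measurableSet fun w hw ↦ ?_
    rw [hf w hw, ← Real.rpow_mul (norm_nonneg _), hs_def, div_mul_cancel₀ _ hp.ne']
  have hle := hKf f ⟨hfd, hint.trans_lt (lt_top_iff_ne_top.2 hD)⟩
  have hnorm : bergmanNorm Ω p α f ≤ ENNReal.ofReal (E ^ (1 / p)) := by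
    rw [← ENNReal.ofReal_rpow_of_pos hE]
    exact ENNReal.rpow_le_rpow (hint.trans hDE) (by positivity)
  have hle2 : ∫⁻ z in Ω, ENNReal.ofReal (‖f z‖ ^ q) ∂μ ≤
      ENNReal.ofReal ((K * E ^ (1 / p)) ^ q) := by
    have h := hle.trans (mul_le_mul_right hnorm _)
    rwa [← ENNReal.ofReal_mul hK.le, one_div q, ENNReal.rpow_inv_le_iff hq,
      ENNReal.ofReal_rpow_of_nonneg (by positivity) hq.le] at h
  -- The upper Whitney bound puts the ball where `1 ≤ 144 δ(z) |ψ'|`; the lower bound `κ δ(z) ≤ r`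
  -- trades `δ(z)` for `r`.
  have hlow : ∀ w ∈ ball z r, (κ / (144 * r)) ^ (s * q) ≤ ‖f w‖ ^ q := by
    intro w hw
    have hw2 : w ∈ ball z (bdryDist Ω z / 2) := ball_subset_ball hW.upper hw
    have h := one_le_mul_norm_deriv_riemann_map hΩ hb hsc hz hψ hs hw2
    rw [hf w (hW.subset hw), ← Real.rpow_mul (norm_nonneg _)]
    have hs0 : 0 ≤ s := div_nonneg (by linarith) hp.le
    refine Real.rpow_le_rpow (by positivity) ?_ (by positivity)
    rw [div_le_iff₀ (by positivity)]
    nlinarith [norm_nonneg (deriv ψ w), hW.lower,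
      mul_le_mul_of_nonneg_right hW.lower (norm_nonneg (deriv ψ w))]
  have hmu : ENNReal.ofReal ((κ / (144 * r)) ^ (s * q)) * μ (ball z r) ≤
      ENNReal.ofReal ((K * E ^ (1 / p)) ^ q) := by
    refine le_trans ?_ hle2
    calc _ = ∫⁻ _ in ball z r, ENNReal.ofReal ((κ / (144 * r)) ^ (s * q)) ∂μ := by
          rw [setLIntegral_const]
      _ ≤ ∫⁻ w in ball z r, ENNReal.ofReal (‖f w‖ ^ q) ∂μ :=
          setLIntegral_mono_ae' measurableSet_ball
            (ae_of_all _ fun w hw ↦ ENNReal.ofReal_le_ofReal (hlow w hw))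
      _ ≤ _ := lintegral_mono_set hW.subset
  have hpos : 0 < (κ / (144 * r)) ^ (s * q) := by positivity
  rw [mul_comm, ← ENNReal.le_div_iff_mul_le (by simp [hpos]) (by simp),
    ← ENNReal.ofReal_div_of_pos hpos] at hmu
  refine hmu.trans (le_of_eq ?_)
  congr 1
  have h1 : (2 + α) * q / p = s * q := by rw [hs_def]; ring
  rw [h1, mul_assoc, ← Real.mul_rpow (by positivity) hr.le, div_eq_mul_inv,
    ← Real.inv_rpow (by positivity)]
  congr 2
  field_simp

/-! ### Mean value inequalities for powers of quasi-nearly subharmonic functions -/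

theorem Complex.volume_ball_eq_ofReal (a : ℂ) {r : ℝ} (hr : 0 ≤ r) :
    volume (ball a r) = ENNReal.ofReal (Real.pi * r ^ 2) := by
  rw [Complex.volume_ball, mul_comm, ENNReal.ofReal_mul Real.pi_pos.le, ENNReal.ofReal_pow hr]
  congr 1
  rw [← NNReal.coe_real_pi, ENNReal.ofReal_coe_nnreal]

namespace IsQuasiNearlySubharmonic

variable {C : ℝ} {Ω : Set ℂ} {g : ℂ → ℝ}

theorem exists_forall_le_of_isCompact (hg : IsQuasiNearlySubharmonic C Ω g) {K : Set ℂ}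
    (hK : IsCompact K) (hKΩ : K ⊆ Ω) : ∃ M, ∀ w ∈ K, g w ≤ M := by
  refine hK.induction_on (p := fun s ↦ ∃ M, ∀ w ∈ s, g w ≤ M) ⟨0, by simp⟩
    (fun s t hst ⟨M, hM⟩ ↦ ⟨M, fun w hw ↦ hM w (hst hw)⟩) ?_ fun x hx ↦ ?_
  · rintro s t ⟨M, hM⟩ ⟨M', hM'⟩
    refine ⟨max M M', fun w hw ↦ hw.elim (fun h ↦ ?_) (fun h ↦ ?_)⟩
    · exact (hM w h).trans (le_max_left _ _)
    · exact (hM' w h).trans (le_max_right _ _)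
  · obtain ⟨M, hM⟩ := hg.locallyBounded x (hKΩ hx)
    exact ⟨_, nhdsWithin_mono x hKΩ hM, M, fun w hw ↦ hw⟩

/-- A pointwise bound of `g` by a multiple of `g ^ p` on a disc, inserted into the defining
inequality. -/
theorem le_of_forall_le_add_mul_rpow (hg : IsQuasiNearlySubharmonic C Ω g) (hC : 0 < C)
    {a : ℂ} {r p t m : ℝ} (hr : 0 < r) (ht : 0 ≤ t) (hm : 0 ≤ m) (hsub : ball a r ⊆ Ω)
    {D : Set ℂ} (hD : ball a r ⊆ D)
    (hN : ∫⁻ w in D, ENNReal.ofReal (g w ^ p) ≠ ∞)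
    (hle : ∀ w ∈ ball a r, g w ≤ t + m * g w ^ p) :
    g a ≤ C / r ^ 2 *
      (t * (Real.pi * r ^ 2) + m * (∫⁻ w in D, ENNReal.ofReal (g w ^ p)).toReal) := by
  set N := ∫⁻ w in D, ENNReal.ofReal (g w ^ p)
  have h1 : ∫⁻ w in ball a r, ENNReal.ofReal (g w) ≤
      ENNReal.ofReal (t * (Real.pi * r ^ 2) + m * N.toReal) := by
    calc ∫⁻ w in ball a r, ENNReal.ofReal (g w)
        ≤ ∫⁻ w in ball a r, (ENNReal.ofReal t + ENNReal.ofReal m * ENNReal.ofReal (g w ^ p)) := by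
          refine setLIntegral_mono_ae' measurableSet_ball (ae_of_all _ fun w hw ↦ ?_)
          have h0 := hg.nonneg w (hsub hw)
          rw [← ENNReal.ofReal_mul hm, ← ENNReal.ofReal_add ht (by positivity)]
          exact ENNReal.ofReal_le_ofReal (hle w hw)
      _ = ENNReal.ofReal t * volume (ball a r) +
          ENNReal.ofReal m * ∫⁻ w in ball a r, ENNReal.ofReal (g w ^ p) := by
          rw [lintegral_add_left measurable_const, setLIntegral_const,
            lintegral_const_mul' _ _ ENNReal.ofReal_ne_top]
      _ ≤ ENNReal.ofReal t * volume (ball a r) + ENNReal.ofReal m * N := by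
          gcongr
          exact lintegral_mono_set hD
      _ = _ := by
          rw [ENNReal.ofReal_add (by positivity) (by positivity), ENNReal.ofReal_mul ht,
            ENNReal.ofReal_mul hm, ENNReal.ofReal_toReal hN,
            Complex.volume_ball_eq_ofReal a hr.le]
  have h2 := (hg.le_mean a r hr hsub).trans (mul_le_mul_right h1 _)
  rwa [← ENNReal.ofReal_mul (by positivity), ENNReal.ofReal_le_ofReal_iff (by positivity)] at h2

/-- Split at the level `t = g a / (2πC)`. Values below `t` contribute at most `g a / 2`, which is
absorbed on the left; above `t`, `g ≤ t^(1-p) g^p` because `1 - p ≤ 0`. -/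
theorem rpow_le_of_one_le (hg : IsQuasiNearlySubharmonic C Ω g) (hC : 0 < C) {p : ℝ}
    (hp : 1 ≤ p) {a : ℂ} {r : ℝ} (hr : 0 < r) (hsub : ball a r ⊆ Ω)
    (hN : ∫⁻ w in ball a r, ENNReal.ofReal (g w ^ p) ≠ ∞) :
    g a ^ p ≤ 2 * C * (2 * Real.pi * C) ^ (p - 1) / r ^ 2 *
      (∫⁻ w in ball a r, ENNReal.ofReal (g w ^ p)).toReal := by
  set n := (∫⁻ w in ball a r, ENNReal.ofReal (g w ^ p)).toReal
  have hn : 0 ≤ n := ENNReal.toReal_nonneg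
  rcases (hg.nonneg a (hsub (mem_ball_self hr))).eq_or_lt with h0 | h0
  · rw [← h0, Real.zero_rpow (by linarith)]
    positivity
  have hπ := Real.pi_pos
  set t := g a / (2 * Real.pi * C) with ht_def
  have ht : 0 < t := by positivity
  have h1 := hg.le_of_forall_le_add_mul_rpow hC (p := p) (m := t ^ (1 - p)) hr ht.le (by positivity)
    hsub subset_rfl hN (fun w hw ↦ by
      have hw0 := hg.nonneg w (hsub hw)
      rcases le_total (g w) t with h | h
      · have : 0 ≤ t ^ (1 - p) * g w ^ p := by positivity
        linarith
      · have hgw : 0 < g w := ht.trans_le h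
        have h2 : g w = g w ^ (1 - p) * g w ^ p := by
          rw [← Real.rpow_add hgw]; simp
        have h3 : g w ^ (1 - p) ≤ t ^ (1 - p) :=
          Real.rpow_le_rpow_of_nonpos ht h (by linarith)
        have h4 : g w ^ (1 - p) * g w ^ p ≤ t ^ (1 - p) * g w ^ p := by gcongr
        linarith)
  have h2 : C / r ^ 2 * (t * (Real.pi * r ^ 2) + t ^ (1 - p) * n) =
      g a / 2 + C / r ^ 2 * t ^ (1 - p) * n := by
    rw [ht_def]; field_simp
  rw [h2] at h1
  have h3 : g a ≤ 2 * (C / r ^ 2 * t ^ (1 - p) * n) := by linarith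
  have h4 : t ^ (1 - p) = g a ^ (1 - p) * (2 * Real.pi * C) ^ (p - 1) := by
    rw [ht_def, Real.div_rpow h0.le (by positivity), div_eq_mul_inv,
      ← Real.rpow_neg (by positivity), neg_sub]
  have h5 : g a ^ p = g a ^ (p - 1) * g a := by
    rw [← Real.rpow_add_one h0.ne', sub_add_cancel]
  have h6 : g a ^ (p - 1) * g a ^ (1 - p) = 1 := by
    rw [← Real.rpow_add h0]; simp
  calc g a ^ p = g a ^ (p - 1) * g a := h5
    _ ≤ g a ^ (p - 1) * (2 * (C / r ^ 2 * t ^ (1 - p) * n)) := by gcongr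
    _ = (g a ^ (p - 1) * g a ^ (1 - p)) * (2 * C * (2 * Real.pi * C) ^ (p - 1) / r ^ 2 * n) := by
      rw [h4]; ring
    _ = _ := by rw [h6, one_mul]

/-- Write `g = g^(1-p) g^p` and bound the first factor by the supremum `M` of `g` weighted with a
power of the distance to the circle. This gives `M ≤ const * M^(1-p) * n`, and `M^(1-p)` can be
divided out because `M` is finite: the closed disc lies in `Ω`, where `g` is locally bounded. -/
theorem rpow_le_of_lt_one (hg : IsQuasiNearlySubharmonic C Ω g) (hC : 0 < C) {p : ℝ}
    (hp0 : 0 < p) (hp : p < 1) {a : ℂ} {r : ℝ} (hr : 0 < r) (hsub : closedBall a r ⊆ Ω)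
    (hN : ∫⁻ w in ball a r, ENNReal.ofReal (g w ^ p) ≠ ∞) :
    g a ^ p ≤ 2 ^ (2 / p) * C / r ^ 2 *
      (∫⁻ w in ball a r, ENNReal.ofReal (g w ^ p)).toReal := by
  set n := (∫⁻ w in ball a r, ENNReal.ofReal (g w ^ p)).toReal
  have hn : 0 ≤ n := ENNReal.toReal_nonneg
  have hsub' : ball a r ⊆ Ω := ball_subset_closedBall.trans hsub
  have ha := mem_ball_self (x := a) hr
  rcases (hg.nonneg a (hsub' ha)).eq_or_lt with h0 | h0
  · rw [← h0, Real.zero_rpow hp0.ne']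
    positivity
  obtain ⟨B, hB⟩ := hg.exists_forall_le_of_isCompact (isCompact_closedBall a r) hsub
  set φ : ℂ → ℝ := fun x ↦ (r - dist x a) ^ (2 / p) * g x
  have hbdd : BddAbove (φ '' ball a r) := by
    refine ⟨r ^ (2 / p) * B, ?_⟩
    rintro _ ⟨x, hx, rfl⟩
    have hx' : dist x a < r := hx
    have h1 := hg.nonneg x (hsub' hx)
    refine mul_le_mul ?_ (hB x (ball_subset_closedBall hx)) h1 (by positivity)
    exact Real.rpow_le_rpow (by linarith) (by linarith [dist_nonneg (x := x) (y := a)])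
      (by positivity)
  set M := sSup (φ '' ball a r)
  have hφM : ∀ x ∈ ball a r, φ x ≤ M := fun x hx ↦ le_csSup hbdd ⟨x, hx, rfl⟩
  have hφa : φ a = r ^ (2 / p) * g a := by simp [φ]
  have hM : 0 < M := lt_of_lt_of_le (by rw [hφa]; positivity) (hφM a ha)
  have key : ∀ x ∈ ball a r, φ x ≤ 2 ^ (2 / p) * C * M ^ (1 - p) * n := by
    intro x hx
    have hx' : dist x a < r := hx
    -- With half the distance to the circle, every point of `B(x, ρ)` is still at distance at least
    -- `ρ` from it, so `g ≤ M ρ^(-2/p)` there.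
    set ρ := (r - dist x a) / 2 with hρ_def
    have hρ : 0 < ρ := by rw [hρ_def]; linarith
    have hxρ : ball x ρ ⊆ ball a r := ball_subset_ball' (by rw [hρ_def]; linarith)
    have h1 := hg.le_of_forall_le_add_mul_rpow hC (p := p) (t := 0)
      (m := (M * ρ ^ (-(2 / p))) ^ (1 - p)) hρ le_rfl (by positivity) (hxρ.trans hsub') hxρ hN
      (fun y hy ↦ by
        have hy0 := hg.nonneg y (hsub' (hxρ hy))
        have hy1 : ρ ≤ r - dist y a := by
          have := dist_triangle y x a
          rw [mem_ball] at hy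
          rw [hρ_def] at hy ⊢
          linarith
        have hy2 : ρ ^ (2 / p) * g y ≤ M := by
          refine le_trans ?_ (hφM y (hxρ hy))
          exact mul_le_mul_of_nonneg_right
            (Real.rpow_le_rpow hρ.le hy1 (by positivity)) hy0
        have hy3 : g y ≤ M * ρ ^ (-(2 / p)) := by
          rw [Real.rpow_neg hρ.le, ← div_eq_mul_inv, le_div_iff₀ (by positivity)]
          linarith
        rw [zero_add]
        calc g y = g y ^ (1 - p) * g y ^ p := by
              rw [← Real.rpow_add' hy0 (by simp)]; simp
          _ ≤ _ := by gcongr)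
    -- The weight exponent `2 / p` is chosen for this: `ρ²` cancels the normalisation of the mean
    -- and `ρ^(-2/p)` cancels the weight at `x`.
    have h2 : (M * ρ ^ (-(2 / p))) ^ (1 - p) = M ^ (1 - p) * (ρ ^ 2 * ρ ^ (-(2 / p))) := by
      rw [Real.mul_rpow hM.le (by positivity), ← Real.rpow_mul hρ.le, ← Real.rpow_two,
        ← Real.rpow_add hρ]
      congr 2
      field_simp
      ring
    have h3 : r - dist x a = 2 * ρ := by rw [hρ_def]; ring
    have h4 : ρ ^ (2 / p) * ρ ^ (-(2 / p)) = 1 := by rw [← Real.rpow_add hρ]; simp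
    calc φ x = 2 ^ (2 / p) * ρ ^ (2 / p) * g x := by
          simp only [φ]
          rw [h3, Real.mul_rpow (by norm_num) hρ.le]
      _ ≤ 2 ^ (2 / p) * ρ ^ (2 / p) * (C / ρ ^ 2 *
          (0 * (Real.pi * ρ ^ 2) + (M * ρ ^ (-(2 / p))) ^ (1 - p) * n)) := by gcongr
      _ = 2 ^ (2 / p) * C * M ^ (1 - p) * n * (ρ ^ (2 / p) * ρ ^ (-(2 / p))) := by
          rw [h2]; field_simp; ring
      _ = _ := by rw [h4, mul_one]
  have hMle : M ≤ 2 ^ (2 / p) * C * M ^ (1 - p) * n := by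
    refine csSup_le ⟨_, a, ha, rfl⟩ ?_
    rintro _ ⟨x, hx, rfl⟩
    exact key x hx
  have hMp : M ^ p ≤ 2 ^ (2 / p) * C * n := by
    have h1 : M = M ^ (1 - p) * M ^ p := by rw [← Real.rpow_add hM]; simp
    have h2 : 0 < M ^ (1 - p) := by positivity
    refine le_of_mul_le_mul_left ?_ h2
    rw [← h1]
    linarith
  have h1 : r ^ 2 * g a ^ p ≤ M ^ p := by
    have h2 : (r ^ (2 / p) * g a) ^ p ≤ M ^ p :=
      Real.rpow_le_rpow (by positivity) (hφa ▸ hφM a ha) hp0.le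
    rwa [Real.mul_rpow (by positivity) h0.le, ← Real.rpow_mul hr.le, div_mul_cancel₀ _ hp0.ne',
      Real.rpow_two] at h2
  rw [div_mul_eq_mul_div, le_div_iff₀ (by positivity)]
  linarith

end IsQuasiNearlySubharmonic

/-- Positive powers of quasi-nearly subharmonic functions satisfy the mean value inequality on
compactly contained discs. -/
theorem exists_rpow_le_mean {C p : ℝ} (hC : 0 < C) (hp : 0 < p) (Ω : Set ℂ) :
    ∃ A : ℝ, 0 < A ∧ ∀ g, IsQuasiNearlySubharmonic C Ω g → ∀ (a : ℂ) (r : ℝ), 0 < r →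
      closedBall a r ⊆ Ω → ENNReal.ofReal (g a ^ p) ≤
        ENNReal.ofReal (A / r ^ 2) * ∫⁻ w in ball a r, ENNReal.ofReal (g w ^ p) := by
  have hπ := Real.pi_pos
  rcases lt_or_ge p 1 with h1 | h1
  · refine ⟨2 ^ (2 / p) * C, by positivity, fun g hg a r hr hsub ↦ ?_⟩
    by_cases hN : ∫⁻ w in ball a r, ENNReal.ofReal (g w ^ p) = ∞
    · rw [hN, ENNReal.mul_top (by rw [Ne, ENNReal.ofReal_eq_zero, not_le]; positivity)]
      exact le_top
    · rw [← ENNReal.ofReal_toReal hN, ← ENNReal.ofReal_mul (by positivity)]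
      exact ENNReal.ofReal_le_ofReal (hg.rpow_le_of_lt_one hC hp h1 hr hsub hN)
  · refine ⟨2 * C * (2 * Real.pi * C) ^ (p - 1), by positivity, fun g hg a r hr hsub ↦ ?_⟩
    by_cases hN : ∫⁻ w in ball a r, ENNReal.ofReal (g w ^ p) = ∞
    · rw [hN, ENNReal.mul_top (by rw [Ne, ENNReal.ofReal_eq_zero, not_le]; positivity)]
      exact le_top
    · rw [← ENNReal.ofReal_toReal hN, ← ENNReal.ofReal_mul (by positivity)]
      exact ENNReal.ofReal_le_ofReal
        (hg.rpow_le_of_one_le hC h1 hr (ball_subset_closedBall.trans hsub) hN)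

/-! ### Carleson embedding for quasi-nearly subharmonic functions -/

theorem measurable_indicator_of_domRestrict {α β : Type*} [MeasurableSpace α] [MeasurableSpace β]
    [Zero β] {s : Set α} (hs : MeasurableSet s) {f : α → β} (hf : Measurable (s.domRestrict f)) :
    Measurable (s.indicator f) := by
  refine measurable_of_restrict_of_restrict_compl hs ?_ ?_
  · have : s.domRestrict (s.indicator f) = s.domRestrict f := by
      ext x; simp
    rwa [this]
  · have : sᶜ.domRestrict (s.indicator f) = fun _ ↦ 0 := by
      ext x; simpa using fun h ↦ absurd h x.2
    rw [this]
    exact measurable_const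

section Embedding

variable {Ω : Set ℂ}

/-- Tonelli needs σ-finiteness, which is not assumed of `μ`. By Lindelöf countably many of the given
balls cover `Ω`. -/
theorem sigmaFinite_restrict_of_measure_ball_lt_top (hΩ : IsOpen Ω) {μ : Measure ℂ} {ρ : ℂ → ℝ}
    (hρ : ∀ z ∈ Ω, 0 < ρ z) (hμ : ∀ z ∈ Ω, μ (ball z (ρ z)) < ∞) :
    SigmaFinite (μ.restrict Ω) := by
  obtain ⟨t, htΩ, htc, htU⟩ := TopologicalSpace.countable_cover_nhdsWithin
    (f := fun z ↦ ball z (ρ z)) (s := Ω)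
    (fun z hz ↦ mem_nhdsWithin_of_mem_nhds (ball_mem_nhds z (hρ z hz)))
  refine Measure.sigmaFinite_of_countable (S := insert Ωᶜ ((fun z ↦ ball z (ρ z)) '' t))
    ((htc.image _).insert _) ?_ ?_
  · rintro s (rfl | ⟨z, hz, rfl⟩)
    · rw [Measure.restrict_apply hΩ.measurableSet.compl]; simp
    · exact (Measure.restrict_apply_le _ _).trans_lt (hμ z (htΩ hz))
  · rw [eq_univ_iff_forall]
    intro x
    by_cases hx : x ∈ Ω
    · obtain ⟨z, hz, hxz⟩ := mem_iUnion₂.1 (htU hx)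
      exact ⟨_, Or.inr ⟨z, hz, rfl⟩, hxz⟩
    · exact ⟨_, Or.inl rfl, hx⟩

theorem isWhitneyBall_half (hΩ : IsOpen Ω) (hb : Bornology.IsBounded Ω) {κ : ℝ}
    (hκ : κ ≤ 1 / 2) {z : ℂ} (hz : z ∈ Ω) : IsWhitneyBall κ Ω z (bdryDist Ω z / 2) := by
  have hδ := bdryDist_pos hΩ hb hz
  exact ⟨hz, (ball_subset_ball (by linarith)).trans (ball_bdryDist_subset hΩ hz),
    by nlinarith, le_rfl⟩

theorem IsQuasiNearlySubharmonic.measurable_indicator {C : ℝ} {g : ℂ → ℝ}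
    (hg : IsQuasiNearlySubharmonic C Ω g) (hΩ : IsOpen Ω) (p α : ℝ) :
    Measurable (Ω.indicator fun w ↦ ENNReal.ofReal (g w ^ p * bdryDist Ω w ^ α)) := by
  refine measurable_indicator_of_domRestrict hΩ.measurableSet ?_
  exact ENNReal.measurable_ofReal.comp ((hg.measurable.pow_const p).mul
    ((continuous_bdryDist.measurable.comp measurable_subtype_coe).pow_const α))

/-- The averages of a function over the discs `B(z, δ(z)/4)`, weighted by `δ(z)^(-s)`, are
integrable with respect to a measure which is of order `s` on Whitney discs. -/
theorem lintegral_weighted_average_le (hΩ : IsOpen Ω) (hb : Bornology.IsBounded Ω)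
    {μ : Measure ℂ} {s c : ℝ} (hs : 0 ≤ s)
    (hμ : ∀ z ∈ Ω, μ (ball z (bdryDist Ω z / 2)) ≤
      ENNReal.ofReal (c * (bdryDist Ω z / 2) ^ s))
    {h : ℂ → ℝ≥0∞} (hh : Measurable (Ω.indicator h)) :
    ∫⁻ z in Ω, ENNReal.ofReal (bdryDist Ω z ^ (-s)) * (∫⁻ w in ball z (bdryDist Ω z / 4), h w) ∂μ
      ≤ ENNReal.ofReal c * ∫⁻ w in Ω, h w := by
  have : SigmaFinite (μ.restrict Ω) := sigmaFinite_restrict_of_measure_ball_lt_top hΩ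
    (fun z hz ↦ half_pos (bdryDist_pos hΩ hb hz))
    (fun z hz ↦ (hμ z hz).trans_lt ENNReal.ofReal_lt_top)
  set k : ℂ × ℂ → ℝ≥0∞ := fun x ↦ ENNReal.ofReal (bdryDist Ω x.1 ^ (-s)) *
    {x : ℂ × ℂ | dist x.2 x.1 < bdryDist Ω x.1 / 4}.indicator (fun x ↦ Ω.indicator h x.2) x
  have hk : Measurable k := by
    refine Measurable.mul ?_ ?_
    · exact ENNReal.measurable_ofReal.comp
        ((continuous_bdryDist.measurable.comp measurable_fst).pow_const _)
    · refine (hh.comp measurable_snd).indicator (IsOpen.measurableSet ?_)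
      have := continuous_bdryDist (Ω := Ω)
      exact isOpen_lt (by fun_prop) (by fun_prop)
  calc ∫⁻ z in Ω, ENNReal.ofReal (bdryDist Ω z ^ (-s)) *
        (∫⁻ w in ball z (bdryDist Ω z / 4), h w) ∂μ
      = ∫⁻ z in Ω, (∫⁻ w, k (z, w)) ∂μ := by
        refine setLIntegral_congr_fun hΩ.measurableSet fun z hz ↦ ?_
        simp only [k]
        rw [lintegral_const_mul' _ _ ENNReal.ofReal_ne_top, ← lintegral_indicator measurableSet_ball]
        congr 1
        refine lintegral_congr fun w ↦ ?_
        by_cases hw : w ∈ ball z (bdryDist Ω z / 4)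
        · have hwΩ : w ∈ Ω := ball_bdryDist_subset hΩ hz
            (ball_subset_ball (by linarith [bdryDist_pos hΩ hb hz]) hw)
          rw [indicator_of_mem hw, indicator_of_mem (by exact hw), indicator_of_mem hwΩ]
        · rw [indicator_of_notMem hw, indicator_of_notMem (by exact hw)]
    _ = ∫⁻ w, ∫⁻ z in Ω, k (z, w) ∂μ := lintegral_lintegral_swap hk.aemeasurable
    _ ≤ ∫⁻ w, Ω.indicator (fun w ↦ ENNReal.ofReal c * h w) w := by
        refine lintegral_mono fun w ↦ ?_
        by_cases hw : w ∈ Ω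
        · rw [indicator_of_mem hw]
          have hδ := bdryDist_pos hΩ hb hw
          calc ∫⁻ z in Ω, k (z, w) ∂μ
              ≤ ∫⁻ z in Ω, (ball w (bdryDist Ω w / 2)).indicator
                  (fun _ ↦ ENNReal.ofReal ((bdryDist Ω w / 2) ^ (-s)) * h w) z ∂μ := by
                refine setLIntegral_mono_ae' hΩ.measurableSet (ae_of_all _ fun z hz ↦ ?_)
                have hδz := bdryDist_pos hΩ hb hz
                by_cases hzw : dist w z < bdryDist Ω z / 4
                · have h1 := bdryDist_le_add_dist (Ω := Ω) z w
                  have h2 := bdryDist_le_add_dist (Ω := Ω) w z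
                  rw [dist_comm] at h1
                  have hzb : z ∈ ball w (bdryDist Ω w / 2) := by
                    rw [mem_ball, dist_comm]; linarith
                  simp only [k]
                  rw [indicator_of_mem hzb, indicator_of_mem (by exact hzw), indicator_of_mem hw]
                  refine mul_le_mul_left (ENNReal.ofReal_le_ofReal ?_) _
                  exact Real.rpow_le_rpow_of_nonpos (half_pos hδ) (by linarith) (neg_nonpos.2 hs)
                · simp only [k]
                  rw [indicator_of_notMem (by exact hzw), mul_zero]
                  exact zero_le
            _ ≤ ENNReal.ofReal ((bdryDist Ω w / 2) ^ (-s)) * h w *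
                  μ (ball w (bdryDist Ω w / 2)) := by
                rw [lintegral_indicator measurableSet_ball, setLIntegral_const]
                gcongr
                exact Measure.restrict_le_self
            _ ≤ ENNReal.ofReal ((bdryDist Ω w / 2) ^ (-s)) * h w *
                  ENNReal.ofReal (c * (bdryDist Ω w / 2) ^ s) := by gcongr; exact hμ w hw
            _ = ENNReal.ofReal c * h w := by
                rw [mul_right_comm, ← ENNReal.ofReal_mul (by positivity)]
                congr 2
                rw [mul_left_comm, ← Real.rpow_add (by positivity)]
                simp
        · rw [indicator_of_notMem hw]
          simp [k, indicator_apply, hw]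
    _ = ENNReal.ofReal c * ∫⁻ w in Ω, h w := by
        rw [lintegral_indicator hΩ.measurableSet, lintegral_const_mul' _ _ ENNReal.ofReal_ne_top]

/-- The local mean value bound is made linear in the local integral before integrating in `μ`; the
surplus power `q / p - 1` goes to the global integral. -/
theorem exists_lintegral_rpow_le_of_measure_ball_le (hΩ : IsOpen Ω) (hb : Bornology.IsBounded Ω)
    {μ : Measure ℂ} {p q α κ C : ℝ} (hp : 0 < p) (hpq : p ≤ q) (hα : -1 < α) (hκ : κ ≤ 1 / 2)
    (hC : 0 < C)
    (hμ : ∃ c : ℝ, 0 < c ∧ ∀ (z : ℂ) (r : ℝ), IsWhitneyBall κ Ω z r →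
      μ (ball z r) ≤ ENNReal.ofReal (c * r ^ ((2 + α) * q / p))) :
    ∃ C' : ℝ, 0 < C' ∧ ∀ g : ℂ → ℝ, IsQuasiNearlySubharmonic C Ω g →
      (∫⁻ z in Ω, ENNReal.ofReal (g z ^ q) ∂μ) ^ (1 / q) ≤
        ENNReal.ofReal C' *
          (∫⁻ z in Ω, ENNReal.ofReal (g z ^ p * bdryDist Ω z ^ α)) ^ (1 / p) := by
  obtain ⟨c, hc, hcμ⟩ := hμ
  obtain ⟨A, hA, hAg⟩ := exists_rpow_le_mean hC hp Ω
  have hq : 0 < q := hp.trans_le hpq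
  have hqp : 1 ≤ q / p := (one_le_div hp).2 hpq
  set s := (2 + α) * q / p with hs_def
  have hs : 0 ≤ s := div_nonneg (mul_nonneg (by linarith) hq.le) hp.le
  -- `16` comes from the squared radius `(δ/4)²`, and `2^|α|` from comparing `δ^α` at the centre and
  -- at points of the ball.
  set A' := 16 * A * 2 ^ |α| with hA'_def
  have hA' : 0 < A' := by positivity
  refine ⟨(A' ^ (q / p) * c) ^ (1 / q), by positivity, fun g hg ↦ ?_⟩
  set h : ℂ → ℝ≥0∞ := fun w ↦ ENNReal.ofReal (g w ^ p * bdryDist Ω w ^ α)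
  set I := ∫⁻ w in Ω, h w with hI_def
  by_cases hI : I = ∞
  · rw [hI, ENNReal.top_rpow_of_pos (by positivity),
      ENNReal.mul_top (by rw [Ne, ENNReal.ofReal_eq_zero, not_le]; positivity)]
    exact le_top
  have hpt : ∀ z ∈ Ω, ENNReal.ofReal (g z ^ q) ≤
      ENNReal.ofReal (A' ^ (q / p)) * I ^ (q / p - 1) *
        (ENNReal.ofReal (bdryDist Ω z ^ (-s)) * ∫⁻ w in ball z (bdryDist Ω z / 4), h w) := by
    intro z hz
    have hδ := bdryDist_pos hΩ hb hz
    have hball : ∀ t < bdryDist Ω z, closedBall z t ⊆ Ω := fun t ht ↦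
      (closedBall_subset_ball ht).trans (ball_bdryDist_subset hΩ hz)
    have hsub : ball z (bdryDist Ω z / 4) ⊆ Ω :=
      ball_subset_closedBall.trans (hball _ (by linarith))
    set J := ∫⁻ w in ball z (bdryDist Ω z / 4), h w
    have hJI : J ≤ I := lintegral_mono_set hsub
    have h1 : ENNReal.ofReal (g z ^ p) ≤
        ENNReal.ofReal (A' * bdryDist Ω z ^ (-(2 + α))) * J := by
      refine (hAg g hg z _ (by positivity) (hball (bdryDist Ω z / 4) (by linarith))).trans ?_
      have h2 : ∫⁻ w in ball z (bdryDist Ω z / 4), ENNReal.ofReal (g w ^ p) ≤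
          ENNReal.ofReal (2 ^ |α| * bdryDist Ω z ^ (-α)) * J := by
        rw [← lintegral_const_mul' _ _ ENNReal.ofReal_ne_top]
        refine setLIntegral_mono_ae' measurableSet_ball (ae_of_all _ fun w hw ↦ ?_)
        have hwΩ := hsub hw
        have hδw := bdryDist_pos hΩ hb hwΩ
        have hg0 := hg.nonneg w hwΩ
        rw [mem_ball, dist_comm] at hw
        have hcmp := bdryDist_le_two_mul_of_dist_le (Ω := Ω) (z := z) (w := w) (by linarith)
        rw [← ENNReal.ofReal_mul (by positivity)]
        refine ENNReal.ofReal_le_ofReal ?_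
        have h3 := Real.rpow_le_rpow_abs_mul_rpow hδ hδw two_pos hcmp.1 (by linarith) α
        have h4 : bdryDist Ω z ^ (-α) * bdryDist Ω z ^ α = 1 := by
          rw [← Real.rpow_add hδ]; simp
        calc g w ^ p = g w ^ p * (bdryDist Ω z ^ (-α) * bdryDist Ω z ^ α) := by rw [h4, mul_one]
          _ ≤ g w ^ p * (bdryDist Ω z ^ (-α) * (2 ^ |α| * bdryDist Ω w ^ α)) := by gcongr
          _ = _ := by ring
      refine (mul_le_mul_right h2 _).trans (le_of_eq ?_)
      rw [← mul_assoc, ← ENNReal.ofReal_mul (by positivity)]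
      congr 2
      rw [neg_add, Real.rpow_add hδ, Real.rpow_neg hδ.le 2, Real.rpow_two, hA'_def]
      field_simp
      norm_num
    have h5 : ENNReal.ofReal (g z ^ q) = ENNReal.ofReal (g z ^ p) ^ (q / p) := by
      have hg0 := hg.nonneg z hz
      rw [ENNReal.ofReal_rpow_of_nonneg (by positivity) (by positivity), ← Real.rpow_mul hg0,
        mul_div_cancel₀ _ hp.ne']
    -- This is where `p ≤ q` is essential: the exponent `q / p - 1` is nonnegative, so `J ≤ I` may
    -- be raised to it.
    have h6 : J ^ (q / p) ≤ I ^ (q / p - 1) * J := by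
      calc J ^ (q / p) = J ^ (q / p - 1 + 1) := by rw [sub_add_cancel]
        _ = J ^ (q / p - 1) * J := by
          rw [ENNReal.rpow_add_of_nonneg _ _ (by linarith) zero_le_one, ENNReal.rpow_one]
        _ ≤ _ := by
          gcongr
    rw [h5]
    calc ENNReal.ofReal (g z ^ p) ^ (q / p)
        ≤ (ENNReal.ofReal (A' * bdryDist Ω z ^ (-(2 + α))) * J) ^ (q / p) := by gcongr
      _ = ENNReal.ofReal (A' ^ (q / p) * bdryDist Ω z ^ (-s)) * J ^ (q / p) := by
          rw [ENNReal.mul_rpow_of_nonneg _ _ (by positivity),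
            ENNReal.ofReal_rpow_of_nonneg (by positivity) (by positivity),
            Real.mul_rpow hA'.le (by positivity), ← Real.rpow_mul hδ.le]
          congr 4
          rw [hs_def]; ring
      _ ≤ ENNReal.ofReal (A' ^ (q / p) * bdryDist Ω z ^ (-s)) * (I ^ (q / p - 1) * J) := by gcongr
      _ = _ := by
          rw [ENNReal.ofReal_mul (by positivity)]; ring
  have hIne : I ^ (q / p - 1) ≠ ∞ := ENNReal.rpow_ne_top_of_nonneg (by linarith) hI
  have hmain : ∫⁻ z in Ω, ENNReal.ofReal (g z ^ q) ∂μ ≤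
      ENNReal.ofReal (A' ^ (q / p) * c) * I ^ (q / p) := by
    calc _ ≤ ∫⁻ z in Ω, ENNReal.ofReal (A' ^ (q / p)) * I ^ (q / p - 1) *
        (ENNReal.ofReal (bdryDist Ω z ^ (-s)) * (∫⁻ w in ball z (bdryDist Ω z / 4), h w)) ∂μ :=
          setLIntegral_mono_ae' hΩ.measurableSet (ae_of_all _ hpt)
      _ ≤ ENNReal.ofReal (A' ^ (q / p)) * I ^ (q / p - 1) * (ENNReal.ofReal c * I) := by
          rw [lintegral_const_mul' _ _ (ENNReal.mul_ne_top ENNReal.ofReal_ne_top hIne)]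
          gcongr
          exact lintegral_weighted_average_le hΩ hb hs
            (fun z hz ↦ hcμ z _ (isWhitneyBall_half hΩ hb hκ hz)) (hg.measurable_indicator hΩ p α)
      _ = ENNReal.ofReal (A' ^ (q / p) * c) * (I ^ (q / p - 1) * I) := by
          rw [ENNReal.ofReal_mul (by positivity)]; ring
      _ = _ := by
          congr 1
          conv_lhs => rw [← ENNReal.rpow_one I, ← ENNReal.rpow_mul, one_mul,
            ← ENNReal.rpow_add_of_nonneg _ _ (by linarith) zero_le_one, sub_add_cancel]
  calc _ ≤ (ENNReal.ofReal (A' ^ (q / p) * c) * I ^ (q / p)) ^ (1 / q) := by gcongr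
    _ = _ := by
      rw [ENNReal.mul_rpow_of_nonneg _ _ (by positivity),
        ENNReal.ofReal_rpow_of_nonneg (by positivity) (by positivity), ← ENNReal.rpow_mul]
      congr 2
      field_simp

end Embedding

/-! ### Moduli of holomorphic functions -/

/-- The indicator stays inside so that one measurability hypothesis covers functions controlled only
on the ball. -/
theorem setLIntegral_ball_eq_circleMap {F : ℂ → ℝ≥0∞} {a : ℂ} {r : ℝ}
    (hF : Measurable ((ball a r).indicator F)) :
    ∫⁻ w in ball a r, F w = ∫⁻ t in Ioi (0 : ℝ), ∫⁻ θ in Ioo (-Real.pi) Real.pi,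
      ENNReal.ofReal t * (ball a r).indicator F (circleMap a t θ) := by
  rw [← lintegral_indicator measurableSet_ball, ← lintegral_add_left_eq_self _ a,
    ← Complex.lintegral_comp_polarCoord_symm, polarCoord_target, Measure.volume_eq_prod,
    ← Measure.prod_restrict]
  have h (p : ℝ × ℝ) : a + Complex.polarCoord.symm p = circleMap a p.1 p.2 := by
    rw [Complex.polarCoord_symm_apply, circleMap, Complex.exp_mul_I]
    push_cast
    rfl
  simp only [h, smul_eq_mul]
  refine lintegral_prod _ (Measurable.aemeasurable ?_)
  refine (ENNReal.measurable_ofReal.comp measurable_fst).mul (hF.comp (Continuous.measurable ?_))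
  simp only [circleMap]
  fun_prop

/-- The **sub-mean value property** of `‖f‖` on circles, with values in `[0, ∞]`. -/
theorem enorm_mul_two_pi_le_lintegral_circleMap {f : ℂ → ℂ} {a : ℂ} {t : ℝ} (ht : 0 ≤ t)
    (hf : DifferentiableOn ℂ f (closedBall a t)) :
    ‖f a‖ₑ * ENNReal.ofReal (2 * Real.pi) ≤
      ∫⁻ θ in Ioo (-Real.pi) Real.pi, ‖f (circleMap a t θ)‖ₑ := by
  have hπ := Real.pi_pos
  have h1 : Real.circleAverage f a t = f a :=
    DiffContOnCl.circleAverage (by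
      rw [abs_of_nonneg ht]; exact hf.diffContOnCl_ball subset_rfl)
  have h2 : ∫ θ in (-Real.pi)..Real.pi, f (circleMap a t θ) = (2 * Real.pi) • f a := by
    have hper : Function.Periodic (fun θ ↦ f (circleMap a t θ)) (2 * Real.pi) :=
      (periodic_circleMap a t).comp f
    have h3 := hper.intervalIntegral_add_eq (-Real.pi) 0
    rw [show -Real.pi + 2 * Real.pi = Real.pi by ring, zero_add] at h3
    rw [h3, ← h1, Real.circleAverage, smul_smul, mul_inv_cancel₀ (by positivity), one_smul]
  rw [intervalIntegral.integral_of_le (by linarith), integral_Ioc_eq_integral_Ioo] at h2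
  have h4 := enorm_integral_le_lintegral_enorm (μ := volume.restrict (Ioo (-Real.pi) Real.pi))
    (fun θ ↦ f (circleMap a t θ))
  rw [h2, enorm_smul, Real.enorm_of_nonneg (by positivity), mul_comm] at h4
  exact h4

/-- The **sub-mean value property** of `‖f‖` on discs, with values in `[0, ∞]`. -/
theorem enorm_mul_volume_ball_le_lintegral {f : ℂ → ℂ} {a : ℂ} {r : ℝ}
    (hf : DifferentiableOn ℂ f (ball a r)) :
    ‖f a‖ₑ * volume (ball a r) ≤ ∫⁻ w in ball a r, ‖f w‖ₑ := by
  have hπ := Real.pi_pos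
  have hmeas : Measurable ((ball a r).indicator fun w ↦ ‖f w‖ₑ) := by
    refine measurable_indicator_of_domRestrict measurableSet_ball ?_
    exact (continuousOn_iff_continuous_domRestrict.1 hf.continuousOn).enorm.measurable
  -- The constant side is put in polar coordinates as well, so the comparison is made circle by
  -- circle and `f` need not be integrable up to the boundary.
  rw [← setLIntegral_const, setLIntegral_ball_eq_circleMap hmeas,
    setLIntegral_ball_eq_circleMap (measurable_const.indicator measurableSet_ball)]
  refine setLIntegral_mono_ae' measurableSet_Ioi (ae_of_all _ fun t ht ↦ ?_)
  rw [lintegral_const_mul' _ _ ENNReal.ofReal_ne_top, lintegral_const_mul' _ _ ENNReal.ofReal_ne_top]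
  refine mul_le_mul_right ?_ _
  have ht0 : 0 < t := ht
  have hmem (θ : ℝ) : circleMap a t θ ∈ ball a r ↔ t < r := by
    rw [mem_ball, dist_eq_norm, circleMap_sub_center, norm_circleMap_zero, abs_of_pos ht0]
  by_cases htr : t < r
  · simp only [indicator_of_mem ((hmem _).2 htr)]
    rw [setLIntegral_const, Real.volume_Ioo, sub_neg_eq_add, ← two_mul]
    exact enorm_mul_two_pi_le_lintegral_circleMap ht0.le (hf.mono (closedBall_subset_ball htr))
  · simp only [indicator_of_notMem (fun h ↦ htr ((hmem _).1 h))]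
    exact le_rfl

/-- The modulus of a holomorphic function is `C`-quasi-nearly subharmonic for `C ≥ 1 / π`. -/
theorem isQuasiNearlySubharmonic_norm {Ω : Set ℂ} {C : ℝ} (hC : 1 / Real.pi ≤ C)
    {f : ℂ → ℂ} (hf : DifferentiableOn ℂ f Ω) : IsQuasiNearlySubharmonic C Ω fun z ↦ ‖f z‖ where
  nonneg z _ := norm_nonneg _
  measurable := (continuousOn_iff_continuous_domRestrict.1 hf.continuousOn).norm.measurable
  locallyBounded z hz := by
    refine ⟨‖f z‖ + 1, ?_⟩
    have h := (hf.continuousOn z hz).norm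
    filter_upwards [h.eventually (gt_mem_nhds (lt_add_one ‖f z‖))] with w hw using hw.le
  le_mean a r hr hsub := by
    have hπ := Real.pi_pos
    have h := enorm_mul_volume_ball_le_lintegral (hf.mono hsub)
    simp only [ofReal_norm]
    rw [Complex.volume_ball_eq_ofReal a hr.le] at h
    calc ‖f a‖ₑ = ENNReal.ofReal (1 / Real.pi / r ^ 2) *
          (‖f a‖ₑ * ENNReal.ofReal (Real.pi * r ^ 2)) := by
          rw [mul_left_comm, ← ENNReal.ofReal_mul (by positivity)]
          have : 1 / Real.pi / r ^ 2 * (Real.pi * r ^ 2) = 1 := by field_simp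
          rw [this]; simp
      _ ≤ ENNReal.ofReal (C / r ^ 2) * ∫⁻ w in ball a r, ‖f w‖ₑ := by gcongr

theorem isCarlesonMeasure_of_isQuasiNearlySubharmonic {Ω : Set ℂ} {μ : Measure ℂ}
    {p q α C : ℝ} (hC : 1 / Real.pi ≤ C)
    (h : ∃ C' : ℝ, 0 < C' ∧ ∀ g : ℂ → ℝ, IsQuasiNearlySubharmonic C Ω g →
      (∫⁻ z in Ω, ENNReal.ofReal (g z ^ q) ∂μ) ^ (1 / q) ≤
        ENNReal.ofReal C' *
          (∫⁻ z in Ω, ENNReal.ofReal (g z ^ p * bdryDist Ω z ^ α)) ^ (1 / p)) :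
    IsCarlesonMeasure Ω q (bergmanSpace Ω p α) (bergmanNorm Ω p α) μ := by
  obtain ⟨K, hK, hKg⟩ := h
  exact ⟨K, hK, fun f hf ↦ hKg _ (isQuasiNearlySubharmonic_norm hC hf.1)⟩

/-- `Ω` is a bounded simply connected domain and `μ` a positive Borel measure on `Ω`.
`κ` is the fixed lower constant of the Whitney balls; for `κ > 1 / 2` there are none.
For `C < 1 / π` the only `C`-quasi-nearly subharmonic function is `0` (the average in the
definition is normalised by `r²`, not by the area `π r²`). -/
theorem theorem2 (Ω : Set ℂ) (hΩ_open : IsOpen Ω) (hΩ_bdd : Bornology.IsBounded Ω)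
    (hΩ_sc : IsSimplyConnected Ω)
    (μ : Measure ℂ) (hμ : μ Ωᶜ = 0)
    (p q α : ℝ) (hp : 0 < p) (hpq : p ≤ q) (hα : -1 < α)
    (κ : ℝ) (hκ : 0 < κ) (hκ' : κ ≤ 1 / 2)
    (C : ℝ) (hC : 1 / Real.pi ≤ C) :
    List.TFAE [
      (∃ c : ℝ, 0 < c ∧ ∀ (z : ℂ) (r : ℝ), IsWhitneyBall κ Ω z r →
        μ (ball z r) ≤ ENNReal.ofReal (c * r ^ ((2 + α) * q / p))),
      (∃ C' : ℝ, 0 < C' ∧ ∀ g : ℂ → ℝ, IsQuasiNearlySubharmonic C Ω g →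
        (∫⁻ z in Ω, ENNReal.ofReal (g z ^ q) ∂μ) ^ (1 / q) ≤
          ENNReal.ofReal C' *
            (∫⁻ z in Ω, ENNReal.ofReal (g z ^ p * bdryDist Ω z ^ α)) ^ (1 / p)),
      IsCarlesonMeasure Ω q (bergmanSpace Ω p α) (bergmanNorm Ω p α) μ] := by
  have hC0 : 0 < C := lt_of_lt_of_le (by positivity) hC
  tfae_have 1 → 2 := exists_lintegral_rpow_le_of_measure_ball_le hΩ_open hΩ_bdd hp hpq hα hκ' hC0
  tfae_have 2 → 3 := isCarlesonMeasure_of_isQuasiNearlySubharmonic hC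
  tfae_have 3 → 1 := exists_measure_ball_le_of_isCarlesonMeasure hΩ_open hΩ_bdd hΩ_sc hp
    (hp.trans_le hpq) hα hκ
  tfae_finish
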